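/- A \emph{semiblock graph} is a finite nonempty graph $\mathcal G$ whose vertices (called semiblocks) are pairwise disjoint nonempty finite sets. A \emph{round representation} is a pair $\Phi=(\mathcal B(\Phi),F_r)$, where $\mathcal B(\Phi)=B_1,\dots,B_n$ ($n\ge 1$) is an ordering of a family of pairwise disjoint nonempty finite sets, considered cyclically (indices modulo $n$), and $F_r:\mathcal B(\Phi)\to\mathcal B(\Phi)$ satisfies $F_r(B_i)\in[B_i,F_r(B_{i+1})]$ for all $i$; here $[B_i,B_j]$ is the range $B_i,B_{i+1},\dots,B_j$. Write $B\to W$ when $W\in(B,F_r(B)]$. Round representations are assumed normal: $B\to W$ and $W\to B$ never hold together. The round graph represented by $\Phi$ is the semiblock graph $\mathcal G=\mathcal G(\Phi)$ on $\mathcal B(\Phi)$ in which $B,W$ are adjacent iff $B\to W$ or $W\to B$; $\Delta(\mathcal G)$ is its maximum degree. Let $F_l(B_i)$ be the unique $B_j$ with ($B_j\to B_i$ or $B_j=B_i$) and ($B_{j-1}=B_i$ or $B_{j-1}\not\to B_i$); let $N_r(B_i)=B_{i+1}$ if $B_i\to B_{i+1}$ and $N_r(B_i)=B_i$ otherwise;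 let $N_l(B_i)=B_{i-1}$ if $B_{i-1}\to B_i$ and $N_l(B_i)=B_i$ otherwise. A \emph{base round representation} $\Phi$ of $\mathcal G$ is an implementation of $\Phi$ in the memory of a random access machine. Each semiblock $B$ has a record, which holds the list of the vertices of $B$, near pointers to the records of $N_l(B)$ and $N_r(B)$, references to two self pointers $S_l(B),S_r(B)$ (cells that point to the record of $B$), and far pointers, which reference the self pointer $S_l$ of $F_l(B)$ and the self pointer $S_r$ of $F_r(B)$. Moreover there is a linked list, in arbitrary order, with one pointer for each connected component of $\mathcal G$, to the record of an arbitrary semiblock of that component. The machine has unit costs, loads, stores, assignments, additions of constants and comparisons of registers; its input is the pointer to this linked list. A \emph{co-bipartition} of a graph is an ordered pair $\langle X|Y\rangle$ of disjoint, possibly empty cliques whose union is the vertex set; a graph is \emph{co-bipartite} if it has a co-bipartition. A \emph{co-component} of $\mathcal G$ is a subgraph induced by the vertex set of a connected component of the complement $\overline{\mathcal G}$. A \emph{co-contig pair} of $\Phi$ is a pair $\langle\mathcal X|\mathcal Y\rangle$ of (possibly empty) ranges of $\mathcal B(\Phi)$ that is a co-bipartition of some co-component of $\mathcal G$. A \emph{natural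 ordering} of the co-contig pairs of $\Phi$ is a sequence $\langle\mathcal X_1|\mathcal Y_1\rangle,\dots,\langle\mathcal X_s|\mathcal Y_s\rangle$ of co-contig pairs such that, as a cyclic ordering, $\mathcal B(\Phi)$ is the concatenation $\mathcal X_1\bullet\dots\bullet\mathcal X_s\bullet\mathcal Y_1\bullet\dots\bullet\mathcal Y_s$; in particular every co-component of $\mathcal G$ is described by exactly one of the pairs. \textbf{Lemma.} There are one program and one constant $c$ such that, for every round graph $\mathcal G$ and every base round representation $\Phi$ of $\mathcal G$ given as input, the program halts after at most $c\,(\Delta(\mathcal G)+1)$ steps, leaves the memory as it was, and reports whether $\mathcal G$ is co-bipartite; if $\mathcal G$ is co-bipartite, it also outputs, within these steps, a natural ordering of the co-contig pairs of $\Phi$, where each nonempty range is given by the pointers to its leftmost and rightmost semiblocks and each empty range by two NULL pointers. -/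

import Mathlib

/-! ### Cyclic ranges, round representations and the graphs they represent -/

/-- The range `[l, r]` of the cyclic ordering `0, 1, …, n - 1`: the list `l, l + 1, …, r`, with
indices modulo `n`. -/
def cyclicRange {n : ℕ} [NeZero n] (l r : Fin n) : List (Fin n) :=
  (List.range ((r - l : Fin n).val + 1)).map (fun k => l + Fin.ofNat n k)

/-- A (normal) round representation with `n` semiblocks of vertices from `V`.  The semiblock at
position `i` of the ordering is `block i`; since semiblocks are nonempty and pairwise disjoint, they
are identified with their positions.  `far i` is the position of the right far neighbor.
`normal` says that no two semiblocks reach each other (`B → W` and `W → B`), where `B → W` means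
that `W` lies in `(B, far B]`. -/
structure RoundRep (V : Type*) (n : ℕ) [NeZero n] where
  block : Fin n → Finset V
  block_nonempty : ∀ i, (block i).Nonempty
  block_disjoint : ∀ i j, i ≠ j → Disjoint (block i) (block j)
  far : Fin n → Fin n
  round : ∀ i, far i ∈ cyclicRange i (far (i + 1))
  normal : ∀ i j, ¬ ((j ≠ i ∧ j ∈ cyclicRange i (far i)) ∧ (i ≠ j ∧ i ∈ cyclicRange j (far j)))

/-- A possibly empty range of the cyclic ordering: `none` is the empty range, `some (l, r)` is
`[l, r]`. -/
abbrev Rng (n : ℕ) : Type := Option (Fin n × Fin n)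

/-- The elements of a range, from left to right. -/
def Rng.toList {n : ℕ} [NeZero n] : Rng n → List (Fin n)
  | none => []
  | some (l, r) => cyclicRange l r

theorem mem_cyclicRange {n : ℕ} [NeZero n] (l r k : Fin n) :
    k ∈ cyclicRange l r ↔ k - l ≤ r - l := by
  unfold cyclicRange
  simp only [List.mem_map, List.mem_range]
  constructor
  · rintro ⟨a, ha, rfl⟩
    have : a < n := by have := (r - l).isLt; omega
    rw [add_sub_cancel_left, Fin.le_def]
    simp [Fin.ofNat, Nat.mod_eq_of_lt this]
    omega
  · intro h
    refine ⟨(k - l).val, ?_, ?_⟩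
    · rw [Fin.le_def] at h; omega
    · have : Fin.ofNat n (k - l).val = k - l := by
        ext; simp [Fin.ofNat, Nat.mod_eq_of_lt (k - l).isLt]
      rw [this]; abel

namespace RoundRep

variable {V : Type*} {n : ℕ} [NeZero n] (Φ : RoundRep V n)

/-- `B → W`, that is, `W ∈ (B, F_r(B)]`. -/
def Reaches (i j : Fin n) : Prop := j ≠ i ∧ j ∈ cyclicRange i (Φ.far i)

instance : DecidableRel Φ.Reaches := fun i j =>
  inferInstanceAs (Decidable (j ≠ i ∧ j ∈ cyclicRange i (Φ.far i)))

/-- The round graph `𝒢(Φ)`, on the (positions of the) semiblocks. -/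
def graph : SimpleGraph (Fin n) where
  Adj i j := Φ.Reaches i j ∨ Φ.Reaches j i
  symm := ⟨fun _ _ h => h.symm⟩
  loopless := ⟨fun _ h => h.elim (fun h => h.1 rfl) (fun h => h.1 rfl)⟩

instance : DecidableRel Φ.graph.Adj := fun i j =>
  inferInstanceAs (Decidable (Φ.Reaches i j ∨ Φ.Reaches j i))

/-- `j` is the left far neighbor of `i`. -/
def IsFarLeft (i j : Fin n) : Prop :=
  (Φ.Reaches j i ∨ j = i) ∧ (j - 1 = i ∨ ¬ Φ.Reaches (j - 1) i)

theorem reaches_succ {i j : Fin n} (h : Φ.Reaches j i) (hne : j + 1 ≠ i) :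
    Φ.Reaches (j + 1) i := by
  obtain ⟨h0, h1⟩ := h
  refine ⟨fun e => hne e.symm, ?_⟩
  rw [mem_cyclicRange] at h1 ⊢
  have h2 := Φ.round j
  rw [mem_cyclicRange] at h2
  have h3 := h1.trans h2
  have ha : i - j ≠ 0 := sub_ne_zero.mpr h0
  have hb : Φ.far (j + 1) - j ≠ 0 := by
    intro e
    rw [e] at h3
    exact ha (le_antisymm h3 (Fin.zero_le _))
  rw [← sub_sub, ← sub_sub, Fin.le_def, Fin.val_sub_one_of_ne_zero ha,
    Fin.val_sub_one_of_ne_zero hb]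
  rw [Fin.le_def] at h3
  omega

theorem val_succ_of_ne_zero {d : Fin n} (h : d + 1 ≠ 0) : (d + 1).val = d.val + 1 := by
  have h1 := Fin.val_sub_one_of_ne_zero h
  rw [add_sub_cancel_right] at h1
  have h2 : (d + 1).val ≠ 0 := fun e => h (Fin.ext (by simpa using e))
  rw [h1, Nat.sub_add_cancel (Nat.one_le_iff_ne_zero.mpr h2)]

theorem reaches_of_le {i e d : Fin n} (h : d = 0 ∨ Φ.Reaches (i - d) i) (hle : e ≤ d) :
    e = 0 ∨ Φ.Reaches (i - e) i := by
  obtain ⟨k, hk⟩ : ∃ k, d.val = e.val + k := ⟨d.val - e.val, by rw [Fin.le_def] at hle; omega⟩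
  induction k generalizing d with
  | zero => obtain rfl : d = e := Fin.ext (by omega)
            exact h
  | succ k ih =>
    have hd : d ≠ 0 := fun e0 => by rw [e0] at hk; simp at hk
    have hv := Fin.val_sub_one_of_ne_zero hd
    refine ih (d := d - 1) ?_ (by rw [Fin.le_def]; omega) (by omega)
    by_cases h1 : d - 1 = 0
    · exact Or.inl h1
    · right
      have h2 : i - (d - 1) = i - d + 1 := by abel
      rw [h2]
      refine Φ.reaches_succ (h.resolve_left hd) ?_
      intro h3
      rw [← h2] at h3
      exact h1 (by simpa using h3)

theorem existsUnique_isFarLeft (i : Fin n) : ∃! j, Φ.IsFarLeft i j := by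
  classical
  have key : ∀ d, (d = 0 ∨ Φ.Reaches (i - d) i) ↔ (Φ.Reaches (i - d) i ∨ i - d = i) := by
    intro d
    rw [or_comm, sub_eq_self]
  let S : Finset (Fin n) := Finset.univ.filter (fun d => d = 0 ∨ Φ.Reaches (i - d) i)
  have hS : S.Nonempty := ⟨0, by simp [S]⟩
  have hm : Φ.IsFarLeft i (i - S.max' hS) := by
    refine ⟨(key _).mp (Finset.mem_filter.mp (S.max'_mem hS)).2, ?_⟩
    by_contra hc
    push Not at hc
    obtain ⟨h1, h2⟩ := hc
    rw [sub_sub] at h1 h2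
    have h3 : S.max' hS + 1 ≠ 0 := fun e => h1 (by rw [e, sub_zero])
    have h4 : S.max' hS + 1 ∈ S := Finset.mem_filter.mpr ⟨Finset.mem_univ _, Or.inr h2⟩
    have h5 := S.le_max' _ h4
    rw [Fin.le_def, val_succ_of_ne_zero h3] at h5
    omega
  refine ⟨i - S.max' hS, hm, ?_⟩
  · have uniq : ∀ d e : Fin n, Φ.IsFarLeft i (i - d) → Φ.IsFarLeft i (i - e) → ¬ d < e := by
      intro d e hd he hlt
      have hne : d + 1 ≠ 0 := by
        intro h0
        have h2 : (d + 1).val = 0 := by rw [h0]; simp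
        rw [Fin.val_add_one_of_lt' (by have := e.isLt; rw [Fin.lt_def] at hlt; omega)] at h2
        exact Nat.succ_ne_zero _ h2
      have hle : d + 1 ≤ e := by
        rw [Fin.le_def, val_succ_of_ne_zero hne]
        exact hlt
      have h1 := (Φ.reaches_of_le ((key e).mpr he.1) hle).resolve_left hne
      rcases hd.2 with h2 | h2
      · rw [sub_sub, sub_eq_self] at h2
        exact hne h2
      · rw [sub_sub] at h2
        exact h2 h1
    intro j hj
    have hj' : j = i - (i - j) := by abel
    rw [hj'] at hj ⊢
    rcases lt_trichotomy (i - j) (S.max' hS) with h | h | h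
    · exact absurd h (uniq _ _ hj hm)
    · rw [h]
    · exact absurd h (uniq _ _ hm hj)

/-- The left far neighbor `F_l(B)`. -/
noncomputable def farLeft (i : Fin n) : Fin n := (Φ.existsUnique_isFarLeft i).choose

theorem isFarLeft_farLeft (i : Fin n) : Φ.IsFarLeft i (Φ.farLeft i) :=
  (Φ.existsUnique_isFarLeft i).choose_spec.1

/-- The right near neighbor `N_r(B)`. -/
def nearRight (i : Fin n) : Fin n := if Φ.Reaches i (i + 1) then i + 1 else i

/-- The left near neighbor `N_l(B)`. -/
def nearLeft (i : Fin n) : Fin n := if Φ.Reaches (i - 1) i then i - 1 else i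

end RoundRep

/-! ### Co-bipartite graphs, co-contig pairs and natural orderings -/

/-- `⟨X | Y⟩` is a co-bipartition of the subgraph of `G` induced by `K`: `X` and `Y` are disjoint,
their union is `K`, and both are independent in the complement of `G`.  One of them may be empty. -/
def IsCoBipartition {α : Type*} (G : SimpleGraph α) (K X Y : Set α) : Prop :=
  X ∪ Y = K ∧ Disjoint X Y ∧ Gᶜ.IsIndepSet X ∧ Gᶜ.IsIndepSet Y

/-- `G` is co-bipartite. -/
def IsCoBipartite {α : Type*} (G : SimpleGraph α) : Prop :=
  ∃ X Y : Set α, IsCoBipartition G Set.univ X Y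

namespace RoundRep

variable {V : Type*} {n : ℕ} [NeZero n] (Φ : RoundRep V n)

/-- `⟨X | Y⟩` is a co-contig pair of `Φ`: the ranges `X` and `Y` form a co-bipartition of some
co-component of `𝒢(Φ)`, i.e. of a connected component of the complement. -/
def IsCoContigPair (p : Rng n × Rng n) : Prop :=
  ∃ C : Φ.graphᶜ.ConnectedComponent,
    IsCoBipartition Φ.graph C.supp {i | i ∈ p.1.toList} {i | i ∈ p.2.toList}

/-- `⟨X₁ | Y₁⟩, …, ⟨X_s | Y_s⟩` is a natural ordering of the co-contig pairs of `Φ`: as a cyclic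
ordering, `ℬ(Φ)` is `X₁ • … • X_s • Y₁ • … • Y_s`.  As this concatenation lists each semiblock
exactly once, each co-component is described by exactly one of the pairs. -/
def IsNaturalOrdering (L : List (Rng n × Rng n)) : Prop :=
  (∀ p ∈ L, Φ.IsCoContigPair p) ∧
    ((L.map (fun p => p.1.toList)).flatten ++ (L.map (fun p => p.2.toList)).flatten).IsRotated
      (List.finRange n)

end RoundRep

/-! ### The machine: a random access machine with structured programs and unit costs

There are registers and a memory, both indexed by `ℕ`, and a write-only output tape.  The only
arithmetic is the addition of a constant; registers may be used as pointers. -/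

namespace Machine

structure State where
  reg : ℕ → ℕ
  mem : ℕ → ℕ
  out : List ℕ

/-- Comparisons of two registers. -/
inductive Test where
  | eq (x y : ℕ)
  | ne (x y : ℕ)
  | lt (x y : ℕ)

def Test.Holds (s : State) : Test → Prop
  | .eq x y => s.reg x = s.reg y
  | .ne x y => s.reg x ≠ s.reg y
  | .lt x y => s.reg x < s.reg y

inductive Prog where
  /-- `x := c` -/
  | const (x c : ℕ)
  /-- `x := y + c` -/
  | add (x y c : ℕ)
  /-- `x := mem[y + c]` -/
  | load (x y c : ℕ)
  /-- `mem[x + c] := y` -/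
  | store (x c y : ℕ)
  /-- write the contents of `x` on the output tape -/
  | emit (x : ℕ)
  | seq (p q : Prog)
  | ite (b : Test) (p q : Prog)
  | while (b : Test) (p : Prog)

/-- `Exec P s t s'`: started in state `s`, the program `P` halts in state `s'` after `t` steps.
Each elementary instruction and each evaluation of a test takes one step. -/
inductive Exec : Prog → State → ℕ → State → Prop
  | const (s : State) (x c : ℕ) :
      Exec (.const x c) s 1 { s with reg := Function.update s.reg x c }
  | add (s : State) (x y c : ℕ) :
      Exec (.add x y c) s 1 { s with reg := Function.update s.reg x (s.reg y + c) }
  | load (s : State) (x y c : ℕ) :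
      Exec (.load x y c) s 1 { s with reg := Function.update s.reg x (s.mem (s.reg y + c)) }
  | store (s : State) (x c y : ℕ) :
      Exec (.store x c y) s 1 { s with mem := Function.update s.mem (s.reg x + c) (s.reg y) }
  | emit (s : State) (x : ℕ) :
      Exec (.emit x) s 1 { s with out := s.out ++ [s.reg x] }
  | seq {p q : Prog} {s s' s'' : State} {t t' : ℕ} :
      Exec p s t s' → Exec q s' t' s'' → Exec (.seq p q) s (t + t') s''
  | ite_true {b : Test} {p q : Prog} {s s' : State} {t : ℕ} :
      b.Holds s → Exec p s t s' → Exec (.ite b p q) s (1 + t) s'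
  | ite_false {b : Test} {p q : Prog} {s s' : State} {t : ℕ} :
      ¬ b.Holds s → Exec q s t s' → Exec (.ite b p q) s (1 + t) s'
  | while_true {b : Test} {p : Prog} {s s' s'' : State} {t t' : ℕ} :
      b.Holds s → Exec p s t s' → Exec (.while b p) s' t' s'' →
        Exec (.while b p) s (1 + t + t') s''
  | while_false {b : Test} {p : Prog} {s : State} :
      ¬ b.Holds s → Exec (.while b p) s 1 s

/-- The initial state: the memory is `m`, register `0` holds `input`, the other registers hold `0`
and the output tape is empty. -/
def start (m : ℕ → ℕ) (input : ℕ) : State where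
  reg := Function.update (fun _ => 0) 0 input
  mem := m
  out := []

end Machine

/-! ### Base round representations in memory -/

/-- The memory `m` holds at `p` a linked list with the given entries: a list cell at `p ≠ 0` has its
entry in `m p` and the pointer to the next cell in `m (p + 1)`; the empty list is the pointer `0`
(`NULL`). -/
def ListAt (m : ℕ → ℕ) (p : ℕ) : List ℕ → Prop
  | [] => p = 0
  | v :: l => p ≠ 0 ∧ m p = v ∧ ListAt m (m (p + 1)) l

/-- The memory `m` holds the base round representation `Φ`, accessible through the pointer `head`.
The record of the semiblock `i` starts at the address `addr i`; its cells are
`+0` the list of the vertices of the semiblock (vertices being stored under the names `name`),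
`+1`, `+2` the near pointers `N_l`, `N_r`, which reference records,
`+3`, `+4` references to the self pointers `S_l`, `S_r`, which are cells that point to the record,
`+5`, `+6` the far pointers `F_l`, `F_r`, which reference the self pointers `S_l` and `S_r`,
respectively, of the far neighbors.
The family of contigs is a linked list, in any order, with one pointer for each connected component
of `𝒢(Φ)`, which references the record of an arbitrary semiblock of that component.  The near and
far neighbors of a semiblock within its contig are those within `Φ`. -/
structure IsBaseRep {V : Type*} {n : ℕ} [NeZero n] (Φ : RoundRep V n) (name : V → ℕ)
    (addr : Fin n → ℕ) (m : ℕ → ℕ) (head : ℕ) : Prop where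
  name_injOn : Set.InjOn name {v | ∃ i, v ∈ Φ.block i}
  addr_injective : Function.Injective addr
  addr_ne_zero : ∀ i, addr i ≠ 0
  vertices : ∀ i, ∃ l : List V, l.Nodup ∧ (∀ v, v ∈ l ↔ v ∈ Φ.block i) ∧
    ListAt m (m (addr i)) (l.map name)
  nearLeft : ∀ i, m (addr i + 1) = addr (Φ.nearLeft i)
  nearRight : ∀ i, m (addr i + 2) = addr (Φ.nearRight i)
  selfLeft : ∀ i, m (m (addr i + 3)) = addr i
  selfRight : ∀ i, m (m (addr i + 4)) = addr i
  farLeft : ∀ i, m (addr i + 5) = m (addr (Φ.farLeft i) + 3)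
  farRight : ∀ i, m (addr i + 6) = m (addr (Φ.far i) + 4)
  contigs : ∃ l : List (Fin n), ListAt m head (l.map addr) ∧
    (l.map Φ.graph.connectedComponentMk).Nodup ∧
    ∀ C : Φ.graph.ConnectedComponent, C ∈ l.map Φ.graph.connectedComponentMk

/-- A range is output as the two pointers to its leftmost and rightmost semiblocks; the empty range
is output as two `NULL` pointers. -/
def Rng.pointers {n : ℕ} (addr : Fin n → ℕ) : Rng n → List ℕ
  | none => [0, 0]
  | some (l, r) => [addr l, addr r]

/-- The output that encodes a sequence of pairs of ranges. -/
def pairsOutput {n : ℕ} (addr : Fin n → ℕ) (L : List (Rng n × Rng n)) : List ℕ :=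
  (L.map (fun p => p.1.pointers addr ++ p.2.pointers addr)).flatten

/-! The cyclic ordering is unrolled to positions in ℕ, read modulo `n`. Let `lim p` be the first
position after `p` that `p` fails to reach. It is monotone, commutes with the shift by `n`, and
satisfies `p < lim p ≤ p + n`. For `p < q < p + n`, the semiblocks at `p` and `q` are non-adjacent
exactly when `lim p ≤ q` and `lim q ≤ p + n` (`compl_adj_pos`). The combinatorics thus becomes
inequalities for `lim`, and the machine decides those it needs by comparing pointers
(`farLeft_eq_pos_iff`).

To search for two cliques, start from `x₀` and `y₀ = lim x₀`. If `y₀` reaches `x₀` around the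
circle, `[x₀, y₀)` and `[y₀, x₀ + n)` are cliques. Otherwise `(x₀, y₀)` is an edge of the
complement, and its ends are advanced one at a time through complement edges. If both ends get stuck
at `(x, y)`, then `[x + 1, y + 1)` and `[y + 1, x + 1 + n)` are cliques. If an end gets to `lim x₀`
or `lim y₀` first, the forced colours of a two-colouring of the complement clash. Both stretches
have length at most Δ + 1, and a cut gives `n ≤ 2 (Δ + 1)`, so a full traversal is affordable once a
cut is known.

Given a cut, the co-components are peeled off from the left ends `a`, `b` of what remains of the two
cliques. A semiblock without non-neighbours is a co-component by itself. If neither `a` nor `b` is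
of this kind, then they are non-adjacent (`IsPartialOrdering.apart`), and the same extension from
`(a, b)` sweeps out their whole co-component (`IsPartialOrdering.append_ext`).

Near pointers give no successor at the right end of a contig. A co-bipartite graph has at most two
components; if contigs have ends, three left far pointers lead to a left end, and with two
components the left end reaches the right end of its contig. Each claim holds because a failure
produces a triangle in the complement. Hence the missing successors are found in constant time, or
co-bipartiteness is refuted. -/

/-- The element of the cyclic ordering at the position `p`. -/
def pos (n : ℕ) [NeZero n] (p : ℕ) : Fin n := Fin.ofNat n p

/-! ### Arithmetic of unrolled cyclic positions. -/

section pos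

variable {n : ℕ} [NeZero n]

theorem pos_val (i : Fin n) : pos n i.val = i := by
  ext; simp [pos]

theorem val_pos (p : ℕ) : (pos n p).val = p % n := rfl

theorem pos_add_self (p : ℕ) : pos n (p + n) = pos n p := by
  ext; simp [val_pos]

theorem pos_succ (p : ℕ) : pos n (p + 1) = pos n p + 1 := by
  ext; simp [pos, Fin.val_add]

theorem pos_eq_pos {p q : ℕ} : pos n p = pos n q ↔ p ≡ q [MOD n] := by
  rw [Fin.ext_iff, val_pos, val_pos]; rfl

/-- The start `k` of the window is left free because different arguments cut the circle at different
places. -/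
theorem eq_of_pos_eq {p q k : ℕ} (h : pos n p = pos n q) (hp : k ≤ p) (hp' : p < k + n)
    (hq : k ≤ q) (hq' : q < k + n) : p = q := by
  rw [pos_eq_pos] at h
  obtain h1 | h1 := le_total p q
  · have h2 := (Nat.modEq_iff_dvd' h1).mp h
    have := Nat.eq_zero_of_dvd_of_lt h2 (by omega)
    omega
  · have h2 := (Nat.modEq_iff_dvd' h1).mp h.symm
    have := Nat.eq_zero_of_dvd_of_lt h2 (by omega)
    omega

theorem pos_ne_pos {p q : ℕ} (h : p < q) (h' : q < p + n) : pos n q ≠ pos n p :=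
  fun e => by have := eq_of_pos_eq (k := p) e (by omega) h' le_rfl (by omega); omega

theorem pos_add (p d : ℕ) : pos n (p + d) = pos n p + pos n d := by
  ext; simp [pos, Fin.val_add]

theorem val_pos_sub_pos {p q : ℕ} (h : p ≤ q) (h' : q < p + n) :
    (pos n q - pos n p).val = q - p := by
  obtain ⟨d, rfl⟩ := Nat.exists_eq_add_of_le h
  rw [pos_add, add_sub_cancel_left, val_pos, Nat.mod_eq_of_lt (by omega)]
  omega

theorem exists_pos_eq (k : ℕ) (i : Fin n) : ∃ p, k ≤ p ∧ p < k + n ∧ pos n p = i := by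
  refine ⟨k + (i - pos n k).val, by omega, by omega, ?_⟩
  rw [pos_add, pos_val, add_sub_cancel]

theorem cyclicRange_pos {p q : ℕ} (h : p ≤ q) (h' : q < p + n) :
    cyclicRange (pos n p) (pos n q) = (List.range' p (q + 1 - p)).map (pos n) := by
  rw [cyclicRange, val_pos_sub_pos h h', List.range'_eq_map_range, List.map_map]
  rw [show q - p + 1 = q + 1 - p by omega]
  refine List.map_congr_left fun k _ => ?_
  exact (pos_add p k).symm

/-- Sliding the window by one moves its first element to the end, which is a rotation. -/
theorem isRotated_finRange (s : ℕ) :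
    ((List.range' s n).map (pos n)).IsRotated (List.finRange n) := by
  have h0 : (List.range' 0 n).map (pos n) = List.finRange n := by
    rw [List.finRange_eq_pmap_range, ← List.range_eq_range']
    apply List.ext_getElem
    · simp
    · intro i h1 h2
      ext
      simp only [List.length_map, List.length_range] at h1
      simp [val_pos, Nat.mod_eq_of_lt h1]
  induction s with
  | zero => rw [h0]
  | succ s ih =>
    refine List.IsRotated.trans ?_ ih
    obtain ⟨k, hk⟩ : ∃ k, n = k + 1 := Nat.exists_eq_succ_of_ne_zero (NeZero.ne n)
    have h1 : (List.range' s n).map (pos n)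
        = pos n s :: (List.range' (s + 1) k).map (pos n) := by
      conv_lhs => rw [show List.range' s n = List.range' s (k + 1) by rw [← hk]]
      rw [List.range'_succ, List.map_cons]
    have h2 : (List.range' (s + 1) n).map (pos n)
        = (List.range' (s + 1) k).map (pos n) ++ [pos n s] := by
      conv_lhs => rw [show List.range' (s + 1) n = List.range' (s + 1) (k + 1) by rw [← hk]]
      rw [List.range'_concat, List.map_append, List.map_singleton]
      rw [show s + 1 + 1 * k = s + n by omega, pos_add_self]
    rw [h1, h2]
    exact List.isRotated_append

end pos

/-! ### The reach function `lim` and the pointers in terms of it. -/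

namespace RoundRep

variable {V : Type*} {n : ℕ} [NeZero n] (Φ : RoundRep V n)

/-- The first position after `p` that is not reached from `p`. -/
def lim (p : ℕ) : ℕ := p + (Φ.far (pos n p) - pos n p).val + 1

theorem lt_lim (p : ℕ) : p < Φ.lim p := by unfold lim; omega

theorem lim_le (p : ℕ) : Φ.lim p ≤ p + n := by
  unfold lim; have := (Φ.far (pos n p) - pos n p).isLt; omega

theorem lim_add_self (p : ℕ) : Φ.lim (p + n) = Φ.lim p + n := by
  unfold lim; rw [pos_add_self]; omega

theorem pos_lim_sub_one (p : ℕ) : pos n (Φ.lim p - 1) = Φ.far (pos n p) := by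
  unfold lim; rw [Nat.add_sub_cancel, pos_add, pos_val, add_sub_cancel]

/-- This is the round condition after unrolling. -/
theorem lim_le_succ (p : ℕ) : Φ.lim p ≤ Φ.lim (p + 1) := by
  have h := Φ.round (pos n p)
  rw [mem_cyclicRange, Fin.le_def] at h
  by_cases h1 : (Φ.far (pos n (p + 1)) - pos n (p + 1)).val + 1 < n
  · have h2 : Φ.far (pos n p + 1) - pos n p
        = pos n ((Φ.far (pos n (p + 1)) - pos n (p + 1)).val + 1) := by
      rw [pos_succ _, pos_val, pos_succ]; abel
    rw [h2, val_pos, Nat.mod_eq_of_lt h1] at h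
    unfold lim; omega
  -- Here `p + 1` reaches all other semiblocks, so its limit is `p + 1 + n`, beyond any possible
  -- limit of `p`.
  · have := Φ.lim_le p
    unfold lim at *; omega

theorem lim_mono : Monotone Φ.lim := monotone_nat_of_le_succ Φ.lim_le_succ

theorem reaches_pos {p q : ℕ} (h : p < q) (h' : q < p + n) :
    Φ.Reaches (pos n p) (pos n q) ↔ q < Φ.lim p := by
  unfold Reaches
  rw [mem_cyclicRange, Fin.le_def, val_pos_sub_pos h.le h']
  have := pos_ne_pos h h'
  unfold lim
  simp only [ne_eq, this, not_false_eq_true, true_and]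
  omega

/-- Normality after unrolling: if `p` reaches `q`, then `q` cannot reach `p + n`, the next copy of
`p`. -/
theorem lim_le_of_lt {p q : ℕ} (h : p < q) (h' : q < p + n) (hr : q < Φ.lim p) :
    Φ.lim q ≤ p + n := by
  by_contra hc
  refine Φ.normal (pos n p) (pos n q) ⟨(Φ.reaches_pos h h').mpr hr, ?_⟩
  have := (Φ.reaches_pos (p := q) (q := p + n) h' (by omega)).mpr (by omega)
  rwa [pos_add_self] at this

theorem compl_adj_pos {p q : ℕ} (h : p < q) (h' : q < p + n) :
    Φ.graphᶜ.Adj (pos n p) (pos n q) ↔ Φ.lim p ≤ q ∧ Φ.lim q ≤ p + n := by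
  have h1 := Φ.reaches_pos h h'
  have h2 := Φ.reaches_pos (p := q) (q := p + n) h' (by omega)
  rw [pos_add_self] at h2
  rw [SimpleGraph.compl_adj]
  have h3 : Φ.graph.Adj (pos n p) (pos n q) ↔ (q < Φ.lim p ∨ p + n < Φ.lim q) := by
    rw [← h1, ← h2]; rfl
  rw [h3]
  have := (pos_ne_pos h h').symm
  simp only [ne_eq, this, not_false_eq_true, true_and]
  omega

theorem farLeft_eq_iff {i j : Fin n} : Φ.farLeft i = j ↔ Φ.IsFarLeft i j := by
  constructor
  · rintro rfl; exact Φ.isFarLeft_farLeft i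
  · exact fun h => (Φ.existsUnique_isFarLeft i).unique (Φ.isFarLeft_farLeft i) h

/-- By `hy`, the predecessor `y` is `x` itself or does not reach it, so the maximality clause of
`IsFarLeft` is automatic for `y + 1`. All that remains is whether `y + 1` reaches around to `x`. One
pointer comparison thus decides an inequality for `lim`. -/
theorem farLeft_eq_pos_iff {x y : ℕ} (h : x ≤ y) (h' : y < x + n)
    (hy : x = y ∨ Φ.lim y ≤ x + n) :
    Φ.farLeft (pos n x) = pos n (y + 1) ↔ x + n < Φ.lim (y + 1) := by
  rw [farLeft_eq_iff, IsFarLeft]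
  have h1 : pos n (y + 1) - 1 = pos n y := by rw [pos_succ, add_sub_cancel_right]
  rw [h1]
  have h2 : (pos n y = pos n x ∨ ¬ Φ.Reaches (pos n y) (pos n x)) := by
    rcases hy with rfl | hy
    · exact Or.inl rfl
    · rcases h.eq_or_lt with rfl | h
      · exact Or.inl rfl
      right
      rw [← pos_add_self x, Φ.reaches_pos h' (by omega)]
      omega
  simp only [h2, and_true]
  rcases (Nat.succ_le_of_lt h').eq_or_lt with e | e
  · rw [Nat.succ_eq_add_one] at e
    rw [e, pos_add_self]
    have := Φ.lt_lim (x + n)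
    simp [this]
  · rw [← pos_add_self x, Φ.reaches_pos (by omega) (by omega)]
    have := (pos_ne_pos (n := n) (p := y + 1) (q := x + n) (by omega) (by omega)).symm
    simp [this]

/-- The test for a semiblock without non-neighbours; compare `not_apart_of_lt_lim_lim`. -/
theorem farLeft_pos_eq_pos_lim_iff (x : ℕ) :
    Φ.farLeft (pos n x) = pos n (Φ.lim x) ↔ x + n < Φ.lim (Φ.lim x) := by
  have h1 := Φ.lt_lim x
  have h2 := Φ.lim_le x
  have h3 := Φ.farLeft_eq_pos_iff (x := x) (y := Φ.lim x - 1) (by omega) (by omega) ?_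
  · rwa [Nat.sub_add_cancel (by omega)] at h3
  · by_cases h : x = Φ.lim x - 1
    · exact Or.inl h
    · exact Or.inr (Φ.lim_le_of_lt (by omega) (by omega) (by omega))

theorem farLeft_pos_eq_pos_succ_iff {x y : ℕ} (h : x < y) (h' : y < x + n) (hx : Φ.lim x ≤ y) :
    Φ.farLeft (pos n y) = pos n (x + 1) ↔ y < Φ.lim (x + 1) := by
  have h1 := Φ.farLeft_eq_pos_iff (x := y) (y := x + n) (by omega) (by omega)
    (Or.inr (by rw [lim_add_self]; omega))
  rw [show x + n + 1 = x + 1 + n by omega, lim_add_self, pos_add_self] at h1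
  rw [h1]; omega

theorem nearRight_pos (p : ℕ) :
    Φ.nearRight (pos n p) = if Φ.lim p = p + 1 then pos n p else pos n (p + 1) := by
  unfold nearRight
  have h1 := Φ.lt_lim p
  have h2 := Φ.lim_le p
  rw [← pos_succ]
  -- With a single semiblock, `p + 1` is a full turn from `p`, outside the range of `reaches_pos`.
  by_cases hn : n = 1
  · have h3 : Φ.lim p = p + 1 := by omega
    have h4 : pos n (p + 1) = pos n p := by subst hn; exact Subsingleton.elim _ _
    simp [h3, h4]
  · have := NeZero.ne n
    have key := Φ.reaches_pos (p := p) (q := p + 1) (by omega) (by omega)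
    simp only [key]
    by_cases h3 : Φ.lim p = p + 1
    · simp [h3]
    · rw [if_pos (by omega), if_neg h3]

theorem nearRight_pos_eq_iff (p : ℕ) :
    Φ.nearRight (pos n p) = pos n p ↔ Φ.lim p = p + 1 := by
  rw [nearRight_pos]
  split_ifs with h
  · simp [h]
  · simp only [h, iff_false]
    have h1 := Φ.lt_lim p
    have h2 := Φ.lim_le p
    exact pos_ne_pos (by omega) (by omega)

theorem nearLeft_pos_succ_eq_iff (p : ℕ) :
    Φ.nearLeft (pos n (p + 1)) = pos n (p + 1) ↔ Φ.lim p = p + 1 := by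
  unfold nearLeft
  have h1 := Φ.lt_lim p
  have h2 := Φ.lim_le p
  rw [pos_succ, add_sub_cancel_right, ← pos_succ]
  by_cases hn : n = 1
  · have h3 : Φ.lim p = p + 1 := by omega
    have h4 : pos n (p + 1) = pos n p := by subst hn; exact Subsingleton.elim _ _
    simp [h3, h4]
  · have := NeZero.ne n
    have key := Φ.reaches_pos (p := p) (q := p + 1) (by omega) (by omega)
    simp only [key]
    have := (pos_ne_pos (n := n) (p := p) (q := p + 1) (by omega) (by omega)).symm
    by_cases h3 : Φ.lim p = p + 1
    · simp [h3]
    · simp [h3, this]; omega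

/-- The positions strictly between `p` and `lim p` carry distinct neighbours of `p`. Every
non-constant time bound rests on this. -/
theorem lim_sub_le_maxDegree (p : ℕ) : Φ.lim p - p ≤ Φ.graph.maxDegree + 1 := by
  classical
  have h1 : Finset.image (pos n) (Finset.Ioo p (Φ.lim p)) ⊆ Φ.graph.neighborFinset (pos n p) := by
    intro i hi
    simp only [Finset.mem_image, Finset.mem_Ioo] at hi
    obtain ⟨q, ⟨h1, h2⟩, rfl⟩ := hi
    have := Φ.lim_le p
    rw [SimpleGraph.mem_neighborFinset]
    exact Or.inl ((Φ.reaches_pos h1 (by omega)).mpr h2)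
  have h2 := Finset.card_le_card h1
  rw [Finset.card_image_of_injOn, SimpleGraph.card_neighborFinset_eq_degree, Nat.card_Ioo] at h2
  · have := Φ.graph.degree_le_maxDegree (pos n p)
    omega
  · intro a ha b hb hab
    simp only [Finset.coe_Ioo, Set.mem_Ioo] at ha hb
    have := Φ.lim_le p
    exact eq_of_pos_eq (k := p) hab (by omega) (by omega) (by omega) (by omega)

end RoundRep

/-! ### Obstructions to co-bipartiteness. -/

theorem IsCoBipartite.exists_coloring {α : Type*} {G : SimpleGraph α} (h : IsCoBipartite G) :
    ∃ c : α → Prop, ∀ i j, Gᶜ.Adj i j → (c i ↔ ¬ c j) := by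
  obtain ⟨X, Y, hU, hd, hX, hY⟩ := h
  refine ⟨fun i => i ∈ X, fun i j hij => ?_⟩
  have hmem : ∀ k, k ∉ X → k ∈ Y := fun k hk =>
    ((Set.mem_union _ _ _).mp (hU ▸ Set.mem_univ k)).resolve_left hk
  constructor
  · intro h1 h2
    exact hX h1 h2 hij.ne hij
  · intro h1
    by_contra h2
    exact hY (hmem i h2) (hmem j h1) hij.ne hij

theorem not_isCoBipartite_of_triangle {α : Type*} {G : SimpleGraph α} {i j k : α}
    (h1 : Gᶜ.Adj i j) (h2 : Gᶜ.Adj j k) (h3 : Gᶜ.Adj i k) : ¬ IsCoBipartite G := by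
  intro h
  obtain ⟨c, hc⟩ := h.exists_coloring
  have := hc _ _ h1
  have := hc _ _ h2
  have := hc _ _ h3
  tauto

/-! ### Advancing along complement edges. -/

namespace RoundRep

variable {V : Type*} {n : ℕ} [NeZero n] (Φ : RoundRep V n)

/-- For positions `i ≤ j < i + n`: the semiblocks at `i` and `j` are distinct and not adjacent. -/
def Apart (i j : ℕ) : Prop := Φ.lim i ≤ j ∧ Φ.lim j ≤ i + n

variable {Φ}

theorem Apart.compl_adj {i j : ℕ} (h : Φ.Apart i j) : Φ.graphᶜ.Adj (pos n i) (pos n j) := by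
  have h1 := Φ.lt_lim i
  have h2 := Φ.lt_lim j
  obtain ⟨h3, h4⟩ := h
  exact (Φ.compl_adj_pos (by omega) (by omega)).mpr ⟨h3, h4⟩

theorem Apart.add_self {i j : ℕ} (h : Φ.Apart i j) : Φ.Apart j (i + n) := by
  obtain ⟨h3, h4⟩ := h
  exact ⟨h4, by rw [lim_add_self]; omega⟩

theorem apart_of_compl_adj {i j : ℕ} (h : i ≤ j) (h' : j < i + n)
    (ha : Φ.graphᶜ.Adj (pos n i) (pos n j)) : Φ.Apart i j := by
  rcases h.eq_or_lt with rfl | h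
  · exact absurd rfl ha.ne
  · exact (Φ.compl_adj_pos h h').mp ha

/-- `(x, y)` arises from `(x₀, y₀)` by advancing one of the positions at a time, where after each
step the two positions are again not adjacent. -/
inductive Ext (Φ : RoundRep V n) (x₀ y₀ : ℕ) : ℕ → ℕ → Prop
  | refl : Ext Φ x₀ y₀ x₀ y₀
  | right {x y : ℕ} : Ext Φ x₀ y₀ x y → Φ.lim (y + 1) ≤ x + n → Ext Φ x₀ y₀ x (y + 1)
  | left {x y : ℕ} : Ext Φ x₀ y₀ x y → Φ.lim (x + 1) ≤ y → Ext Φ x₀ y₀ (x + 1) y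

theorem Ext.le {x₀ y₀ x y : ℕ} (h : Ext Φ x₀ y₀ x y) : x₀ ≤ x ∧ y₀ ≤ y := by
  induction h <;> omega

theorem Ext.apart {x₀ y₀ x y : ℕ} (h : Ext Φ x₀ y₀ x y) (h0 : Φ.Apart x₀ y₀) : Φ.Apart x y := by
  induction h with
  | refl => exact h0
  | right _ h2 ih => exact ⟨ih.1.trans (Nat.le_succ _), h2⟩
  | left _ h2 ih => exact ⟨h2, ih.2.trans (by omega)⟩

/-- After each step the moved position is again joined in the complement to the one that stayed, so
its colour is forced. -/
theorem Ext.coloring {x₀ y₀ x y : ℕ} (h : Ext Φ x₀ y₀ x y) (h0 : Φ.Apart x₀ y₀)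
    {c : Fin n → Prop} (hc : ∀ i j, Φ.graphᶜ.Adj i j → (c i ↔ ¬ c j)) :
    (c (pos n x) ↔ c (pos n x₀)) ∧ (c (pos n y) ↔ ¬ c (pos n x₀)) := by
  induction h with
  | refl => have := hc _ _ h0.compl_adj; tauto
  | right h1 h2 ih =>
    have := hc _ _ ((h1.right h2).apart h0).compl_adj
    tauto
  | left h1 h2 ih =>
    have := hc _ _ ((h1.left h2).apart h0).compl_adj
    tauto

theorem Ext.reachable {x₀ y₀ x y : ℕ} (h : Ext Φ x₀ y₀ x y) (h0 : Φ.Apart x₀ y₀) :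
    (∀ i, x₀ ≤ i → i ≤ x → Φ.graphᶜ.Reachable (pos n x₀) (pos n i)) ∧
      (∀ j, y₀ ≤ j → j ≤ y → Φ.graphᶜ.Reachable (pos n x₀) (pos n j)) := by
  induction h with
  | refl =>
    refine ⟨fun i h1 h2 => ?_, fun j h1 h2 => ?_⟩
    · obtain rfl : x₀ = i := by omega
      exact .refl _
    · obtain rfl : y₀ = j := by omega
      exact h0.compl_adj.reachable
  | @right x y h1 h2 ih =>
    refine ⟨ih.1, fun j h3 h4 => ?_⟩
    rcases h4.eq_or_lt with rfl | h4
    · exact (ih.1 x h1.le.1 le_rfl).trans ((h1.right h2).apart h0).compl_adj.reachable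
    · exact ih.2 j h3 (by omega)
  | @left x y h1 h2 ih =>
    refine ⟨fun i h3 h4 => ?_, ih.2⟩
    rcases h4.eq_or_lt with rfl | h4
    · exact (ih.2 y h1.le.2 le_rfl).trans ((h1.left h2).apart h0).compl_adj.symm.reachable
    · exact ih.1 i h3 (by omega)

/-- The extension forces on `y + 1` the colour of `lim x₀`, but `y + 1 = lim (lim x₀)` is not
adjacent to `lim x₀`. -/
theorem Ext.not_isCoBipartite_right {x₀ x y : ℕ} (h : Ext Φ x₀ (Φ.lim x₀) x y)
    (h0 : Φ.lim (Φ.lim x₀) ≤ x₀ + n) (hx : x < Φ.lim x₀)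
    (hy : y + 1 = Φ.lim (Φ.lim x₀)) (hr : Φ.lim (y + 1) ≤ x + n) :
    ¬ IsCoBipartite Φ.graph := by
  intro hb
  obtain ⟨c, hc⟩ := hb.exists_coloring
  have ha : Φ.Apart x₀ (Φ.lim x₀) := ⟨le_rfl, h0⟩
  have h1 := (h.right hr).coloring ha hc
  have h2 := (Ext.refl (Φ := Φ)).coloring ha hc
  have h3 : Φ.Apart (Φ.lim x₀) (y + 1) := ⟨hy.ge, by omega⟩
  have := hc _ _ h3.compl_adj
  tauto

/-- The extension forces on `x + 1 = lim x₀` the colour of `x₀`, whereas the initial pair forces the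
opposite one. -/
theorem Ext.not_isCoBipartite_left {x₀ x y : ℕ} (h : Ext Φ x₀ (Φ.lim x₀) x y)
    (h0 : Φ.lim (Φ.lim x₀) ≤ x₀ + n) (hx : x + 1 = Φ.lim x₀) (hr : Φ.lim (x + 1) ≤ y) :
    ¬ IsCoBipartite Φ.graph := by
  intro hb
  obtain ⟨c, hc⟩ := hb.exists_coloring
  have ha : Φ.Apart x₀ (Φ.lim x₀) := ⟨le_rfl, h0⟩
  have h1 := (h.left hr).coloring ha hc
  have h2 := (Ext.refl (Φ := Φ)).coloring ha hc
  rw [hx] at h1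
  tauto

/-! ### Cuts of the cyclic ordering into two cliques -/

/-- The ranges `[s, t)` and `[t, s + n)` are cliques, and the first is nonempty. -/
structure IsCut (Φ : RoundRep V n) (s t : ℕ) : Prop where
  lt : s < t
  le : t ≤ s + n
  left : t ≤ Φ.lim s
  right : s + n ≤ Φ.lim t

theorem IsCut.not_apart_left {s t i j : ℕ} (h : IsCut Φ s t) (hi : s ≤ i)
    (hj : j < t) : ¬ Φ.Apart i j := fun ha => by
  have := ha.1; have := Φ.lim_mono hi; have := h.left; omega

theorem IsCut.not_apart_right {s t i j : ℕ} (h : IsCut Φ s t) (hi : t ≤ i)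
    (hj : j < s + n) : ¬ Φ.Apart i j := fun ha => by
  have := ha.1; have := Φ.lim_mono hi; have := h.right; omega

theorem IsCut.not_compl_adj_left {s t i j : ℕ} (h : IsCut Φ s t) (hi : s ≤ i) (hi' : i < t)
    (hj : s ≤ j) (hj' : j < t) : ¬ Φ.graphᶜ.Adj (pos n i) (pos n j) := by
  intro ha
  have := h.le
  rcases le_total i j with hij | hij
  · exact h.not_apart_left hi hj' (apart_of_compl_adj hij (by omega) ha)
  · exact h.not_apart_left hj hi' (apart_of_compl_adj hij (by omega) ha.symm)

theorem IsCut.not_compl_adj_right {s t i j : ℕ} (h : IsCut Φ s t) (hi : t ≤ i) (hi' : i < s + n)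
    (hj : t ≤ j) (hj' : j < s + n) : ¬ Φ.graphᶜ.Adj (pos n i) (pos n j) := by
  intro ha
  have := h.lt
  rcases le_total i j with hij | hij
  · exact h.not_apart_right hi hj' (apart_of_compl_adj hij (by omega) ha)
  · exact h.not_apart_right hj hi' (apart_of_compl_adj hij (by omega) ha.symm)

/-- The positions in `[i, j)`. -/
def posSet (n : ℕ) [NeZero n] (i j : ℕ) : Set (Fin n) := {v | ∃ k, i ≤ k ∧ k < j ∧ pos n k = v}

theorem disjoint_posSet {s i j k l : ℕ} (hi : s ≤ i) (hjk : j ≤ k) (hl : l ≤ s + n) :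
    Disjoint (posSet n i j) (posSet n k l) := by
  rw [Set.disjoint_left]
  rintro v ⟨p, h1, h2, rfl⟩ ⟨q, h3, h4, h5⟩
  have := eq_of_pos_eq (k := s) h5 (by omega) (by omega) (by omega) (by omega)
  omega

theorem IsCut.isIndepSet_left {s t a a' : ℕ} (h : IsCut Φ s t) (ha : s ≤ a) (ha' : a' ≤ t) :
    Φ.graphᶜ.IsIndepSet (posSet n a a') := by
  rintro _ ⟨i, h1, h2, rfl⟩ _ ⟨j, h3, h4, rfl⟩ -
  exact h.not_compl_adj_left (by omega) (by omega) (by omega) (by omega)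

theorem IsCut.isIndepSet_right {s t b b' : ℕ} (h : IsCut Φ s t) (hb : t ≤ b) (hb' : b' ≤ s + n) :
    Φ.graphᶜ.IsIndepSet (posSet n b b') := by
  rintro _ ⟨i, h1, h2, rfl⟩ _ ⟨j, h3, h4, rfl⟩ -
  exact h.not_compl_adj_right (by omega) (by omega) (by omega) (by omega)

theorem IsCut.isCoBipartite {s t : ℕ} (h : IsCut Φ s t) : IsCoBipartite Φ.graph := by
  refine ⟨posSet n s t, posSet n t (s + n), ?_, disjoint_posSet le_rfl le_rfl le_rfl,
    h.isIndepSet_left le_rfl le_rfl, h.isIndepSet_right le_rfl le_rfl⟩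
  rw [Set.eq_univ_iff_forall]
  intro v
  obtain ⟨p, h1, h2, rfl⟩ := exists_pos_eq s v
  by_cases h3 : p < t
  · exact Or.inl ⟨p, h1, h3, rfl⟩
  · exact Or.inr ⟨p, by omega, h2, rfl⟩

/-- Each of the two ranges lies within the reach of its first position. -/
theorem IsCut.le_maxDegree {s t : ℕ} (h : IsCut Φ s t) : n ≤ 2 * (Φ.graph.maxDegree + 1) := by
  have := Φ.lim_sub_le_maxDegree s
  have := Φ.lim_sub_le_maxDegree t
  have := h.left
  have := h.right
  have := h.lt
  omega

/-- No edge of the complement joins `[s, a) ∪ [t, b)` to the remaining positions. -/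
structure IsClosed (Φ : RoundRep V n) (s t a b : ℕ) : Prop where
  left : ∀ i j, s ≤ i → i < a → b ≤ j → j < s + n → ¬ Φ.Apart i j
  right : ∀ i j, a ≤ i → i < t → t ≤ j → j < b → ¬ Φ.Apart i j

/-- The range `[i, j)` of positions, empty if `j ≤ i`. -/
def rng (n : ℕ) [NeZero n] (i j : ℕ) : Rng n :=
  if i < j then some (pos n i, pos n (j - 1)) else none

theorem rng_of_le {i j : ℕ} (h : j ≤ i) : rng n i j = none := if_neg (by omega)

theorem rng_of_lt {i j : ℕ} (h : i < j) : rng n i j = some (pos n i, pos n (j - 1)) := if_pos h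

theorem toList_rng {i j : ℕ} (h : j ≤ i + n) :
    (rng n i j).toList = (List.range' i (j - i)).map (pos n) := by
  unfold rng
  split_ifs with h1
  · rw [Rng.toList, cyclicRange_pos (by omega) (by omega)]
    congr 2; omega
  · rw [Nat.sub_eq_zero_of_le (by omega)]; rfl

theorem setOf_mem_rng {i j : ℕ} (h : j ≤ i + n) :
    {v | v ∈ (rng n i j).toList} = posSet n i j := by
  ext v
  simp only [toList_rng h, posSet, Set.mem_ofPred_eq, List.mem_map, List.mem_range'_1]
  constructor
  · rintro ⟨k, hk, rfl⟩; exact ⟨k, by omega, by omega, rfl⟩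
  · rintro ⟨k, hk, hk', rfl⟩; exact ⟨k, by omega, rfl⟩

/-- Complement edges cross the cut. Since no such edge leaves either of the two closed prefixes,
none leaves their difference; being connected in the complement, the difference is a whole
component. -/
theorem IsCut.isCoContigPair {s t a b a' b' : ℕ} (h : IsCut Φ s t) (ha : s ≤ a)
    (ha' : a' ≤ t) (hb : t ≤ b) (hb' : b' ≤ s + n) (h1 : IsClosed Φ s t a b)
    (h2 : IsClosed Φ s t a' b') {v₀ : Fin n} (hv₀ : v₀ ∈ posSet n a a' ∪ posSet n b b')
    (hr : ∀ v ∈ posSet n a a' ∪ posSet n b b', Φ.graphᶜ.Reachable v₀ v) :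
    Φ.IsCoContigPair (rng n a a', rng n b b') := by
  refine ⟨Φ.graphᶜ.connectedComponentMk v₀, ?_⟩
  have := h.lt
  have := h.le
  simp only
  rw [setOf_mem_rng (by omega), setOf_mem_rng (by omega)]
  refine ⟨?_, disjoint_posSet ha (by omega) hb', h.isIndepSet_left ha ha',
    h.isIndepSet_right hb hb'⟩
  have hclosed : ∀ u v, Φ.graphᶜ.Adj u v → u ∈ posSet n a a' ∪ posSet n b b' →
      v ∈ posSet n a a' ∪ posSet n b b' := by
    rintro _ v huv (⟨i, h3, h4, rfl⟩ | ⟨j, h3, h4, rfl⟩)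
    · obtain ⟨j, h5, h6, rfl⟩ := exists_pos_eq s v
      by_cases h7 : j < t
      · exact absurd huv (h.not_compl_adj_left (by omega) (by omega) h5 h7)
      · have h8 := apart_of_compl_adj (by omega) (by omega) huv
        right
        refine ⟨j, ?_, ?_, rfl⟩
        · by_contra h9
          exact h1.right i j h3 (by omega) (by omega) (by omega) h8
        · by_contra h9
          exact h2.left i j (by omega) (by omega) (by omega) (by omega) h8
    · obtain ⟨i, h5, h6, rfl⟩ := exists_pos_eq s v
      by_cases h7 : i < t
      · have h8 := apart_of_compl_adj (by omega) (by omega) huv.symm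
        left
        refine ⟨i, ?_, ?_, rfl⟩
        · by_contra h9
          exact h1.left i j h5 (by omega) (by omega) (by omega) h8
        · by_contra h9
          exact h2.right i j (by omega) (by omega) (by omega) (by omega) h8
      · exact absurd huv (h.not_compl_adj_right (by omega) (by omega) (by omega) (by omega))
  ext v
  rw [SimpleGraph.ConnectedComponent.mem_supp_iff, SimpleGraph.ConnectedComponent.eq]
  constructor
  · exact fun hv => (hr v hv).symm
  · rintro ⟨w⟩
    clear hr
    induction w with
    | nil => exact hv₀
    | cons huv _ ih => exact hclosed _ _ huv.symm (ih hv₀)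

/-- `L` is a natural ordering of the co-contig pairs within `[s, a) ∪ [t, b)`. -/
structure IsPartialOrdering (Φ : RoundRep V n) (s t a b : ℕ) (L : List (Rng n × Rng n)) :
    Prop where
  le_left : s ≤ a
  left_le : a ≤ t
  le_right : t ≤ b
  right_le : b ≤ s + n
  closed : IsClosed Φ s t a b
  pairs : ∀ p ∈ L, Φ.IsCoContigPair p
  flatten_left : (L.map (fun p => p.1.toList)).flatten = (List.range' s (a - s)).map (pos n)
  flatten_right : (L.map (fun p => p.2.toList)).flatten = (List.range' t (b - t)).map (pos n)

theorem IsCut.isPartialOrdering_nil {s t : ℕ} (h : IsCut Φ s t) :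
    IsPartialOrdering Φ s t s t [] where
  le_left := le_rfl
  left_le := h.lt.le
  le_right := le_rfl
  right_le := h.le
  closed := ⟨fun i j _ _ _ _ => by omega, fun i j _ _ _ _ => by omega⟩
  pairs := by simp
  flatten_left := by simp
  flatten_right := by simp

theorem IsPartialOrdering.isNaturalOrdering {s t : ℕ} {L : List (Rng n × Rng n)}
    (h : IsPartialOrdering Φ s t t (s + n) L) : Φ.IsNaturalOrdering L := by
  refine ⟨h.pairs, ?_⟩
  rw [h.flatten_left, h.flatten_right, ← List.map_append]
  have h1 := h.le_left
  have h2 := h.right_le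
  have h3 := h.le_right
  have := List.range'_append (s := s) (m := t - s) (n := s + n - t) (step := 1)
  rw [show s + 1 * (t - s) = t by omega, show t - s + (s + n - t) = n by omega] at this
  rw [this]
  exact isRotated_finRange s

theorem IsPartialOrdering.append {s t a b a' b' : ℕ} {L : List (Rng n × Rng n)} (hc : IsCut Φ s t)
    (h : IsPartialOrdering Φ s t a b L) (haa : a ≤ a') (ha' : a' ≤ t) (hbb : b ≤ b')
    (hb' : b' ≤ s + n) (h2 : IsClosed Φ s t a' b') {v₀ : Fin n}
    (hv₀ : v₀ ∈ posSet n a a' ∪ posSet n b b')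
    (hr : ∀ v ∈ posSet n a a' ∪ posSet n b b', Φ.graphᶜ.Reachable v₀ v) :
    IsPartialOrdering Φ s t a' b' (L ++ [(rng n a a', rng n b b')]) := by
  have hle := hc.le
  have hlt := hc.lt
  have h3 := h.le_left
  have h4 := h.le_right
  refine ⟨by omega, ha', by omega, hb', h2, ?_, ?_, ?_⟩
  · intro p hp
    rcases List.mem_append.mp hp with hp | hp
    · exact h.pairs p hp
    · rw [List.mem_singleton.mp hp]
      exact hc.isCoContigPair h3 ha' h4 hb' h.closed h2 hv₀ hr
  · have := List.range'_append (s := s) (m := a - s) (n := a' - a) (step := 1)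
    rw [show s + 1 * (a - s) = a by omega, show a - s + (a' - a) = a' - s by omega] at this
    simp [h.flatten_left, toList_rng (n := n) (i := a) (j := a') (by omega), ← this]
  · have := List.range'_append (s := t) (m := b - t) (n := b' - b) (step := 1)
    rw [show t + 1 * (b - t) = b by omega, show b - t + (b' - b) = b' - t by omega] at this
    simp [h.flatten_right, toList_rng (n := n) (i := b) (j := b') (by omega), ← this]

/-! ### Peeling off one co-component. -/

section steps

variable {s t a b : ℕ} {L : List (Rng n × Rng n)}

/-- A non-neighbour `j` would lie at or beyond `lim i`, so by monotonicity it would reach past `i +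
n`. -/
theorem not_apart_of_lt_lim_lim {i j : ℕ} (h : i + n < Φ.lim (Φ.lim i)) : ¬ Φ.Apart i j :=
  fun ha => by have := Φ.lim_mono ha.1; have := ha.2; omega

theorem not_apart_of_lt_lim_lim' {i j : ℕ} (h : j + n < Φ.lim (Φ.lim j)) : ¬ Φ.Apart i j :=
  fun ha => not_apart_of_lt_lim_lim h ha.add_self

theorem IsPartialOrdering.append_left (hc : IsCut Φ s t) (h : IsPartialOrdering Φ s t a b L)
    (ha : a < t) (hu : a + n < Φ.lim (Φ.lim a)) :
    IsPartialOrdering Φ s t (a + 1) b (L ++ [(some (pos n a, pos n a), none)]) := by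
  have h1 := h.append (a' := a + 1) (b' := b) (v₀ := pos n a) hc (by omega) ha le_rfl h.right_le
    ?_ (Or.inl ⟨a, le_rfl, by omega, rfl⟩) ?_
  · rwa [rng_of_lt (by omega), rng_of_le le_rfl, Nat.add_sub_cancel] at h1
  · constructor
    · intro i j h2 h3 h4 h5
      rcases (Nat.le_of_lt_succ h3).eq_or_lt with rfl | h6
      · exact not_apart_of_lt_lim_lim hu
      · exact h.closed.left i j h2 h6 h4 h5
    · intro i j h2 h3 h4 h5
      exact h.closed.right i j (by omega) h3 h4 h5
  · rintro _ (⟨k, h2, h3, rfl⟩ | ⟨k, h2, h3, rfl⟩)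
    · obtain rfl : a = k := by omega
      exact .refl _
    · omega

theorem IsPartialOrdering.append_right (hc : IsCut Φ s t) (h : IsPartialOrdering Φ s t a b L)
    (hb : b < s + n) (hu : b + n < Φ.lim (Φ.lim b)) :
    IsPartialOrdering Φ s t a (b + 1) (L ++ [(none, some (pos n b, pos n b))]) := by
  have h1 := h.append (a' := a) (b' := b + 1) (v₀ := pos n b) hc le_rfl h.left_le (by omega) hb
    ?_ (Or.inr ⟨b, le_rfl, by omega, rfl⟩) ?_
  · rwa [rng_of_lt (i := b) (by omega), rng_of_le le_rfl, Nat.add_sub_cancel] at h1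
  · constructor
    · intro i j h2 h3 h4 h5
      exact h.closed.left i j h2 h3 (by omega) h5
    · intro i j h2 h3 h4 h5
      rcases (Nat.le_of_lt_succ h5).eq_or_lt with rfl | h6
      · exact not_apart_of_lt_lim_lim' hu
      · exact h.closed.right i j h2 h3 h4 h6
  · rintro _ (⟨k, h2, h3, rfl⟩ | ⟨k, h2, h3, rfl⟩)
    · omega
    · obtain rfl : b = k := by omega
      exact .refl _

/-- The witness is `lim a`, the first semiblock missed by `a`. The clique `[s, t)` puts it at or
after `t`, and closedness of the treated part puts it at or after `b`. -/
theorem IsPartialOrdering.exists_apart_left (hc : IsCut Φ s t)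
    (h : IsPartialOrdering Φ s t a b L) (ha : a < t) (hu : Φ.lim (Φ.lim a) ≤ a + n) :
    ∃ j, b ≤ j ∧ j < s + n ∧ Φ.Apart a j := by
  have h0 := h.le_left
  have h1 := Φ.lim_mono h.le_left
  have h2 := hc.left
  have h3 := hc.right
  have h4 : Φ.lim a < s + n := by
    by_contra h5
    have h6 := Φ.lim_mono (Nat.le_of_not_lt h5)
    rw [lim_add_self] at h6
    omega
  have h5 : Φ.Apart a (Φ.lim a) := ⟨le_rfl, hu⟩
  refine ⟨Φ.lim a, ?_, h4, h5⟩
  by_contra h6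
  exact h.closed.right _ _ le_rfl ha (by omega) (by omega) h5

theorem IsPartialOrdering.exists_apart_right (hc : IsCut Φ s t)
    (h : IsPartialOrdering Φ s t a b L) (hb : b < s + n) (hu : Φ.lim (Φ.lim b) ≤ b + n) :
    ∃ i, a ≤ i ∧ i < t ∧ Φ.Apart i b := by
  have h0 := h.le_right
  have h1 := Φ.lim_mono h.le_right
  have h2 := hc.left
  have h3 := hc.right
  -- The first position missed by `b` lies in the next turn; `i` is its copy in the current one.
  obtain ⟨i, hi⟩ : ∃ i, Φ.lim b = i + n := ⟨Φ.lim b - n, by omega⟩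
  rw [hi, lim_add_self] at hu
  have h4 : i < t := by
    by_contra h5
    have h6 := Φ.lim_mono (Nat.le_of_not_lt h5)
    omega
  have h5 : Φ.Apart i b := ⟨by omega, hi.le⟩
  refine ⟨i, ?_, h4, h5⟩
  by_contra h6
  exact h.closed.left _ _ (by omega) (by omega) le_rfl hb h5

/-- Both have a non-neighbour among the remaining semiblocks. As `a` and `b` come first there,
monotonicity of `lim` transfers the two inequalities to the pair itself. -/
theorem IsPartialOrdering.apart (hc : IsCut Φ s t) (h : IsPartialOrdering Φ s t a b L)
    (ha : a < t) (hb : b < s + n) (hua : Φ.lim (Φ.lim a) ≤ a + n)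
    (hub : Φ.lim (Φ.lim b) ≤ b + n) : Φ.Apart a b := by
  obtain ⟨j, h1, h2, h3, h4⟩ := h.exists_apart_left hc ha hua
  obtain ⟨i, h5, h6, h7, h8⟩ := h.exists_apart_right hc hb hub
  have := Φ.lim_mono h1
  have := Φ.lim_mono h5
  exact ⟨by omega, by omega⟩

/-- The stuck extension provides closedness: everything from `x + 1` on reaches beyond `y`, and
everything from `y + 1` on reaches beyond `x + n`. -/
theorem IsPartialOrdering.append_ext (hc : IsCut Φ s t) (h : IsPartialOrdering Φ s t a b L)
    (hab : Φ.Apart a b) {x y : ℕ} (hE : Ext Φ a b x y) (hx : x < t) (hy : y < s + n)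
    (hx' : y < Φ.lim (x + 1)) (hy' : x + n < Φ.lim (y + 1)) :
    IsPartialOrdering Φ s t (x + 1) (y + 1)
      (L ++ [(some (pos n a, pos n x), some (pos n b, pos n y))]) := by
  have hle := hE.le
  have h1 := h.append (a' := x + 1) (b' := y + 1) (v₀ := pos n a) hc (by omega) hx (by omega) hy
    ?_ (Or.inl ⟨a, le_rfl, by omega, rfl⟩) ?_
  · rwa [rng_of_lt (i := a) (by omega), rng_of_lt (i := b) (by omega), Nat.add_sub_cancel,
      Nat.add_sub_cancel] at h1
  · constructor
    · rintro i j h2 h3 h4 h5 ⟨h6, h7⟩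
      have := Φ.lim_mono h4
      omega
    · rintro i j h2 h3 h4 h5 ⟨h6, h7⟩
      have := Φ.lim_mono h2
      omega
  · rintro _ (⟨k, h2, h3, rfl⟩ | ⟨k, h2, h3, rfl⟩)
    · exact (hE.reachable hab).1 k h2 (by omega)
    · exact (hE.reachable hab).2 k h2 (by omega)

end steps

/-! ### Ends of contigs -/

/-- In the window `(e, e + n]`, the left far neighbor is the least position that reaches `p`.
Opening the circle after a right end `e` ensures that no reach enters the window from before it. -/
theorem exists_farLeft_eq {e p : ℕ} (he : Φ.lim e = e + 1) (h : e < p) (h' : p ≤ e + n) :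
    ∃ q, e < q ∧ q ≤ p ∧ Φ.farLeft (pos n p) = pos n q ∧ (q = e + 1 ∨ Φ.lim (q - 1) ≤ p) := by
  classical
  have hex : ∃ q, e < q ∧ p < Φ.lim q := ⟨p, h, Φ.lt_lim p⟩
  obtain ⟨h1, h2⟩ := Nat.find_spec hex
  have h3 : Nat.find hex ≤ p := Nat.find_min' hex ⟨h, Φ.lt_lim p⟩
  have h4 : Nat.find hex = e + 1 ∨ Φ.lim (Nat.find hex - 1) ≤ p := by
    by_contra hc
    push Not at hc
    have := Nat.find_min' hex (m := Nat.find hex - 1) ⟨by omega, hc.2⟩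
    omega
  refine ⟨Nat.find hex, h1, h3, ?_, h4⟩
  set q := Nat.find hex
  rw [farLeft_eq_iff]
  constructor
  · rcases h3.eq_or_lt with h5 | h5
    · rw [h5]; exact Or.inr rfl
    · exact Or.inl ((Φ.reaches_pos h5 (by omega)).mpr h2)
  · have h5 : pos n q - 1 = pos n (q - 1) := by
      conv_lhs => rw [show q = q - 1 + 1 by omega, pos_succ, add_sub_cancel_right]
    rw [h5]
    -- The predecessor of `q` is then `p` itself, one turn earlier, which is the first alternative
    -- in `IsFarLeft`.
    by_cases h6 : p = q - 1 + n
    · left; rw [h6, pos_add_self]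
    right
    rw [Φ.reaches_pos (by omega) (by omega)]
    rcases h4 with h4 | h4
    · rw [h4, Nat.add_sub_cancel]; omega
    · omega

/-- In a co-bipartite graph, three left far pointers lead to the left end of a contig, if any
contig has ends. -/
theorem nearLeft_farLeft_farLeft_farLeft {e : ℕ} (he : Φ.lim e = e + 1)
    (hb : IsCoBipartite Φ.graph) (v : Fin n) :
    Φ.nearLeft (Φ.farLeft (Φ.farLeft (Φ.farLeft v))) =
      Φ.farLeft (Φ.farLeft (Φ.farLeft v)) := by
  obtain ⟨x₀, h1, h2, rfl⟩ := exists_pos_eq (e + 1) v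
  obtain ⟨x₁, h3, h4, h5, h6⟩ := exists_farLeft_eq he (p := x₀) (by omega) (by omega)
  obtain ⟨x₂, h7, h8, h9, h10⟩ := exists_farLeft_eq he (p := x₁) (by omega) (by omega)
  obtain ⟨x₃, h11, h12, h13, h14⟩ := exists_farLeft_eq he (p := x₂) (by omega) (by omega)
  rw [h5, h9, h13]
  have key : ∀ q, e < q → Φ.lim (q - 1) = q → Φ.nearLeft (pos n q) = pos n q := by
    intro q hq hl
    have := (Φ.nearLeft_pos_succ_eq_iff (q - 1)).mpr (by omega)
    rwa [Nat.sub_add_cancel (by omega)] at this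
  apply key x₃ h11
  rcases h14 with rfl | h14
  · exact he
  have hlt := Φ.lt_lim (x₃ - 1)
  by_contra hne
  have hne' : x₃ ≠ e + 1 := by rintro rfl; exact hne he
  have h15 : x₃ < x₂ := by
    rcases h12.eq_or_lt with rfl | h
    · omega
    · exact h
  have h16 : x₂ < x₁ := by
    rcases h8.eq_or_lt with rfl | h
    · exfalso
      have := eq_of_pos_eq (k := e + 1) (h9.symm.trans h13) (by omega) (by omega) (by omega)
        (by omega)
      omega
    · exact h
  have h17 : Φ.lim (x₁ - 1) ≤ x₀ := by
    rcases h6 with rfl | h6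
    · omega
    · exact h6
  -- No position of the window reaches beyond the right end `e + n`; this bounds the reach around
  -- the circle in the three pairs below.
  have hend : ∀ q, q ≤ e + n → Φ.lim q ≤ e + 1 + n := by
    intro q hq
    have := Φ.lim_mono hq
    rw [lim_add_self, he] at this
    exact this
  have a1 : Φ.Apart (x₃ - 1) (x₁ - 1) := ⟨by omega, by have := hend (x₁ - 1) (by omega); omega⟩
  have a2 : Φ.Apart (x₁ - 1) x₀ := ⟨by omega, by have := hend x₀ (by omega); omega⟩
  have a3 : Φ.Apart (x₃ - 1) x₀ := ⟨by omega, by have := hend x₀ (by omega); omega⟩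
  exact not_isCoBipartite_of_triangle a1.compl_adj a2.compl_adj a3.compl_adj hb

theorem exists_lim_eq_of_nearLeft {v : Fin n} (h : Φ.nearLeft v = v) :
    ∃ e, Φ.lim e = e + 1 ∧ v = pos n (e + 1) := by
  obtain ⟨p, h1, h2, rfl⟩ := exists_pos_eq 1 v
  refine ⟨p - 1, ?_, by rw [Nat.sub_add_cancel h1]⟩
  apply (Φ.nearLeft_pos_succ_eq_iff (p - 1)).mp
  rwa [Nat.sub_add_cancel h1]

/-- A contig has at most one left end. -/
theorem eq_of_nearLeft_of_reachable {v w : Fin n} (hv : Φ.nearLeft v = v)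
    (hw : Φ.nearLeft w = w) (h : Φ.graph.Reachable v w) : w = v := by
  obtain ⟨e, he, rfl⟩ := exists_lim_eq_of_nearLeft hv
  obtain ⟨f, h1, h2, rfl⟩ := exists_pos_eq (e + 1) w
  by_contra hne
  have hf : e + 1 < f := by
    rcases h1.eq_or_lt with rfl | h1
    · exact absurd rfl hne
    · exact h1
  have hlf : Φ.lim (f - 1) = f := by
    have := (Φ.nearLeft_pos_succ_eq_iff (f - 1))
    rw [Nat.sub_add_cancel (by omega)] at this
    exact this.mp hw
  -- The stretch between two left ends is closed under adjacency, so a walk from `f` to `e + 1`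
  -- would place `f` in `[e + 1, f)`.
  have key : pos n f ∈ posSet n (e + 1) f := by
    obtain ⟨wk⟩ := h.symm
    have hclosed : ∀ u v, Φ.graph.Adj u v → u ∈ posSet n (e + 1) f → v ∈ posSet n (e + 1) f := by
      rintro _ v ha ⟨p, h3, h4, rfl⟩
      obtain ⟨q, h5, h6, rfl⟩ := exists_pos_eq (e + 1) v
      refine ⟨q, h5, ?_, rfl⟩
      by_contra h7
      have h8 := Φ.lim_mono (show p ≤ f - 1 by omega)
      have h9 := Φ.lim_mono (show q ≤ e + n by omega)
      rw [lim_add_self, he] at h9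
      have h10 : Φ.Apart p q := ⟨by omega, by omega⟩
      exact h10.compl_adj.2 ha
    have h0 : pos n (e + 1) ∈ posSet n (e + 1) f := ⟨e + 1, le_rfl, hf, rfl⟩
    clear hv hw h hne
    generalize pos n f = z at *
    generalize pos n (e + 1) = z' at *
    induction wk with
    | nil => exact h0
    | cons ha _ ih => exact hclosed _ _ ha.symm (ih h0)
  obtain ⟨k, h3, h4, h5⟩ := key
  have := eq_of_pos_eq (k := e + 1) h5 (by omega) (by omega) (by omega) (by omega)
  omega

theorem reachable_farLeft (v : Fin n) : Φ.graph.Reachable v (Φ.farLeft v) := by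
  rcases (Φ.isFarLeft_farLeft v).1 with h | h
  · exact SimpleGraph.Adj.reachable (Or.inr h)
  · rw [h]

theorem reachable_far (v : Fin n) : Φ.graph.Reachable v (Φ.far v) := by
  by_cases h : Φ.far v = v
  · rw [h]
  · refine SimpleGraph.Adj.reachable (Or.inl ⟨h, ?_⟩)
    rw [mem_cyclicRange]

theorem compl_adj_of_not_reachable {v w : Fin n} (h : ¬ Φ.graph.Reachable v w) :
    Φ.graphᶜ.Adj v w := by
  refine ⟨?_, fun ha => h ha.reachable⟩
  rintro rfl
  exact h (.refl _)

/-- In a disconnected co-bipartite graph, the left end of a contig reaches its right end. -/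
theorem nearRight_far_of_nearLeft {v z : Fin n} (hv : Φ.nearLeft v = v)
    (hz : ¬ Φ.graph.Reachable v z) (hb : IsCoBipartite Φ.graph) :
    Φ.nearRight (Φ.far v) = Φ.far v := by
  obtain ⟨e, he, rfl⟩ := exists_lim_eq_of_nearLeft hv
  rw [← Φ.pos_lim_sub_one]
  by_contra hne
  have h1 := Φ.lt_lim (e + 1)
  have hr : Φ.nearRight (pos n (Φ.lim (e + 1) - 1)) = pos n (Φ.lim (e + 1)) := by
    rw [Φ.nearRight_pos_eq_iff] at hne
    rw [Φ.nearRight_pos, if_neg hne, Nat.sub_add_cancel (by omega)]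
  rw [Φ.nearRight_pos_eq_iff] at hne
  have h2 : Φ.lim (e + 1) < e + 1 + n := by
    have h3 := Φ.lim_mono (show Φ.lim (e + 1) - 1 ≤ e + n by have := Φ.lim_le (e + 1); omega)
    rw [lim_add_self, he] at h3
    have := Φ.lt_lim (Φ.lim (e + 1) - 1)
    omega
  have h3 := Φ.lim_mono (show Φ.lim (e + 1) ≤ e + n by omega)
  rw [lim_add_self, he] at h3
  -- The left end and the first semiblock it misses are non-adjacent but in the same component; `z`,
  -- in another one, completes a triangle of the complement.
  have h4 : Φ.Apart (e + 1) (Φ.lim (e + 1)) := ⟨le_rfl, by omega⟩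
  have h5 : Φ.graph.Reachable (pos n (e + 1)) (pos n (Φ.lim (e + 1))) := by
    refine (Φ.pos_lim_sub_one (e + 1) ▸ Φ.reachable_far (pos n (e + 1))).trans ?_
    have h6 := Φ.lt_lim (Φ.lim (e + 1) - 1)
    have h7 := Φ.reaches_pos (p := Φ.lim (e + 1) - 1) (q := Φ.lim (e + 1)) (by omega) (by omega)
    exact SimpleGraph.Adj.reachable (Or.inl (h7.mpr (by omega)))
  exact not_isCoBipartite_of_triangle h4.compl_adj
    (compl_adj_of_not_reachable fun h => hz (h5.trans h)) (compl_adj_of_not_reachable hz) hb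

theorem nearLeft_succ_eq_iff (v : Fin n) :
    Φ.nearLeft (v + 1) = v + 1 ↔ Φ.nearRight v = v := by
  obtain ⟨p, -, -, rfl⟩ := exists_pos_eq 0 v
  rw [nearRight_pos_eq_iff, ← pos_succ, nearLeft_pos_succ_eq_iff]

/-- Otherwise `v` would reach every other semiblock, `z` included. -/
theorem far_add_one_ne {v z : Fin n} (hz : ¬ Φ.graph.Reachable v z) : Φ.far v + 1 ≠ v := by
  intro h
  obtain ⟨p, -, -, rfl⟩ := exists_pos_eq 0 v
  have h1 := Φ.lt_lim p
  have h2 := Φ.lim_le p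
  rw [← Φ.pos_lim_sub_one, ← pos_succ, Nat.sub_add_cancel (by omega)] at h
  obtain ⟨q, h3, h4, rfl⟩ := exists_pos_eq p z
  have h5 : p + n ≤ Φ.lim p := by
    by_contra h6
    exact pos_ne_pos (by omega) (by omega) h
  rcases h3.eq_or_lt with rfl | h3
  · exact hz (.refl _)
  · exact hz (SimpleGraph.Adj.reachable (Or.inl ((Φ.reaches_pos h3 h4).mpr (by omega))))

end RoundRep

/-! ### Reasoning about programs -/

namespace Machine

/-- The state after `v` is assigned to the register `r`. -/
def State.set (s : State) (r v : ℕ) : State := { s with reg := Function.update s.reg r v }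

/-- The state after `v` is written on the output tape. -/
def State.write (s : State) (v : ℕ) : State := { s with out := s.out ++ [v] }

@[simp] theorem State.set_reg (s : State) (r v k : ℕ) :
    (s.set r v).reg k = if k = r then v else s.reg k := by
  simp [State.set, Function.update_apply]

@[simp] theorem State.set_mem (s : State) (r v : ℕ) : (s.set r v).mem = s.mem := rfl
@[simp] theorem State.set_out (s : State) (r v : ℕ) : (s.set r v).out = s.out := rfl
@[simp] theorem State.write_reg (s : State) (v : ℕ) : (s.write v).reg = s.reg := rfl
@[simp] theorem State.write_mem (s : State) (v : ℕ) : (s.write v).mem = s.mem := rfl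
@[simp] theorem State.write_out (s : State) (v : ℕ) : (s.write v).out = s.out ++ [v] := rfl

theorem State.set_set (s : State) (r v w : ℕ) : (s.set r v).set r w = s.set r w := by
  simp [State.set]

/-- `P`, started in `s`, halts after at most `t` steps in a state `s'` such that `Q t s'`. -/
def Runs (P : Prog) (s : State) (Q : ℕ → State → Prop) : Prop :=
  ∃ t s', (∃ t₀ ≤ t, Exec P s t₀ s') ∧ Q t s'

section rules

variable {P P' : Prog} {s : State} {Q Q' : ℕ → State → Prop} {b : Test} {x y c : ℕ}

theorem Runs.mono (h : Runs P s Q) (hQ : ∀ t s', Q t s' → Q' t s') : Runs P s Q' := by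
  obtain ⟨t, s', h1, h2⟩ := h
  exact ⟨t, s', h1, hQ t s' h2⟩

/-- Branches of different cost are merged under one time bound, so that a subroutine has a single
specification. -/
theorem Runs.of_le {T : ℕ} {S : State} (h : Runs P s fun t s' => t ≤ T ∧ s' = S) (hQ : Q T S) :
    Runs P s Q := by
  obtain ⟨t, s', ⟨t₀, h1, h2⟩, h3, rfl⟩ := h
  exact ⟨T, s', ⟨t₀, h1.trans h3, h2⟩, hQ⟩

theorem runs_const (h : Q 1 (s.set x c)) : Runs (.const x c) s Q :=
  ⟨1, _, ⟨1, le_rfl, .const s x c⟩, h⟩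

theorem runs_add (h : Q 1 (s.set x (s.reg y + c))) : Runs (.add x y c) s Q :=
  ⟨1, _, ⟨1, le_rfl, .add s x y c⟩, h⟩

theorem runs_load (h : Q 1 (s.set x (s.mem (s.reg y + c)))) : Runs (.load x y c) s Q :=
  ⟨1, _, ⟨1, le_rfl, .load s x y c⟩, h⟩

theorem runs_emit (h : Q 1 (s.write (s.reg x))) : Runs (.emit x) s Q :=
  ⟨1, _, ⟨1, le_rfl, .emit s x⟩, h⟩

theorem runs_seq (h : Runs P s fun t s' => Runs P' s' fun t' s'' => Q (t + t') s'') :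
    Runs (.seq P P') s Q := by
  obtain ⟨t, s', ⟨t₀, h1, h2⟩, t', s'', ⟨t₀', h3, h4⟩, h5⟩ := h
  exact ⟨t + t', s'', ⟨t₀ + t₀', by omega, .seq h2 h4⟩, h5⟩

theorem runs_ite (h : b.Holds s → Runs P s fun t => Q (1 + t))
    (h' : ¬ b.Holds s → Runs P' s fun t => Q (1 + t)) : Runs (.ite b P P') s Q := by
  by_cases hb : b.Holds s
  · obtain ⟨t, s', ⟨t₀, h1, h2⟩, h3⟩ := h hb
    exact ⟨1 + t, s', ⟨1 + t₀, by omega, .ite_true hb h2⟩, h3⟩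
  · obtain ⟨t, s', ⟨t₀, h1, h2⟩, h3⟩ := h' hb
    exact ⟨1 + t, s', ⟨1 + t₀, by omega, .ite_false hb h2⟩, h3⟩

theorem runs_while (h : b.Holds s → Runs P s fun t s' => Runs (.while b P) s' fun t' s'' =>
      Q (1 + t + t') s'') (h' : ¬ b.Holds s → Q 1 s) : Runs (.while b P) s Q := by
  by_cases hb : b.Holds s
  · obtain ⟨t, s', ⟨t₀, h1, h2⟩, t', s'', ⟨t₀', h3, h4⟩, h5⟩ := h hb
    exact ⟨1 + t + t', s'', ⟨1 + t₀ + t₀', by omega, .while_true hb h2 h4⟩, h5⟩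
  · exact ⟨1, s, ⟨1, le_rfl, .while_false hb⟩, h' hb⟩

end rules

end Machine

/-! ### The program

Registers `1`, `2`, `3` tell how to pass from the right end of a contig to the next semiblock:
to `2` from the semiblock `1`, to `3` from any other one.  The register `30` always holds `0`. -/

namespace CoContig

open Machine Machine.Prog

/-- The next semiblock in the cyclic ordering. -/
def succProg (d x : ℕ) : Prog :=
  .seq (.load 20 x 2)
    (.ite (.eq 20 x) (.ite (.eq x 1) (.add d 2 0) (.add d 3 0)) (.add d 20 0))

/-- The left far neighbor. -/
def farLeftProg (d x : ℕ) : Prog := .seq (.load d x 5) (.load d d 0)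

/-- The semiblock after the right far neighbor. -/
def limProg (d x : ℕ) : Prog := .seq (.load 19 x 6) (.seq (.load 19 19 0) (succProg d 19))

/-- Extends a part of a co-component whose rightmost semiblocks are in `4` and `5` up to its end.
The register `8` is set when it is done, and `21` when it runs into the limits in `6` and `7`. -/
def extendProg : Prog :=
  .while (.eq 8 30)
    (.seq (succProg 9 5) (.seq (farLeftProg 10 4)
      (.ite (.ne 9 10)
        (.ite (.eq 9 7) (.seq (.const 8 1) (.const 21 1)) (.add 5 9 0))
        (.seq (succProg 9 4) (.seq (farLeftProg 10 5)
          (.ite (.ne 9 10)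
            (.ite (.eq 9 6) (.seq (.const 8 1) (.const 21 1)) (.add 4 9 0))
            (.const 8 1)))))))

/-- The contents of the next semiblock for the machine, in terms of the pointer `v`. -/
def nextPtr (s : State) (v : ℕ) : ℕ :=
  if s.mem (v + 2) = v then (if v = s.reg 1 then s.reg 2 else s.reg 3) else s.mem (v + 2)

theorem nextPtr_congr {s s' : State} (hm : s'.mem = s.mem) (h1 : s'.reg 1 = s.reg 1)
    (h2 : s'.reg 2 = s.reg 2) (h3 : s'.reg 3 = s.reg 3) : nextPtr s' = nextPtr s := by
  funext v; simp only [nextPtr, hm, h1, h2, h3]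

@[simp] theorem nextPtr_write (s : State) (v : ℕ) : nextPtr (s.write v) = nextPtr s :=
  nextPtr_congr rfl rfl rfl rfl

@[simp] theorem nextPtr_set (s : State) {r : ℕ} (v : ℕ) (h : 4 ≤ r) :
    nextPtr (s.set r v) = nextPtr s := by
  apply nextPtr_congr (State.set_mem ..) <;> (rw [State.set_reg, if_neg (by omega)])

/-! ### Specifications of the pointer subroutines. -/

section specs

variable {s : State} {Q : ℕ → State → Prop} {d x : ℕ}

theorem runs_succProg (hx : x ≠ 20)
    (h : Q 4 ((s.set 20 (s.mem (s.reg x + 2))).set d (nextPtr s (s.reg x)))) :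
    Runs (succProg d x) s Q := by
  refine Runs.of_le (runs_seq (runs_load (runs_ite (fun h1 => runs_ite
    (fun h2 => runs_add ?_) (fun h2 => runs_add ?_)) (fun h1 => runs_add ?_)))) h
  · simp only [Test.Holds, State.set_reg, if_true, if_neg hx] at h1 h2
    rw [nextPtr, if_pos h1, if_pos (by simpa using h2)]
    simp
  · simp only [Test.Holds, State.set_reg, if_true, if_neg hx] at h1 h2
    rw [nextPtr, if_pos h1, if_neg (by simpa using h2)]
    simp
  · simp only [Test.Holds, State.set_reg, if_true, if_neg hx] at h1
    rw [nextPtr, if_neg h1]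
    simp

theorem runs_farLeftProg (h : Q 2 (s.set d (s.mem (s.mem (s.reg x + 5))))) :
    Runs (farLeftProg d x) s Q := by
  refine Runs.of_le (runs_seq (runs_load (runs_load ?_))) h
  simp [State.set_set]

theorem runs_limProg
    (h : Q 6 (((s.set 19 (s.mem (s.mem (s.reg x + 6)))).set 20
      (s.mem (s.mem (s.mem (s.reg x + 6)) + 2))).set d
        (nextPtr s (s.mem (s.mem (s.reg x + 6)))))) :
    Runs (limProg d x) s Q := by
  refine Runs.of_le (runs_seq (runs_load (runs_seq (runs_load
    (runs_succProg (by norm_num) ?_))))) h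
  simp [State.set_set]

end specs

/-! ### Correctness of the extension loop. -/

section correctness

variable {V : Type*} {n : ℕ} [NeZero n] {Φ : RoundRep V n} {name : V → ℕ} {addr : Fin n → ℕ}
  {m : ℕ → ℕ} {head : ℕ}

theorem mem_farLeft (hM : IsBaseRep Φ name addr m head) (i : Fin n) :
    m (m (addr i + 5)) = addr (Φ.farLeft i) := by
  rw [hM.farLeft, hM.selfLeft]

theorem mem_far (hM : IsBaseRep Φ name addr m head) (i : Fin n) :
    m (m (addr i + 6)) = addr (Φ.far i) := by
  rw [hM.farRight, hM.selfRight]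

theorem ptr_eq_iff (hM : IsBaseRep Φ name addr m head) {k p q : ℕ} (hp : k ≤ p)
    (hp' : p < k + n) (hq : k ≤ q) (hq' : q < k + n) :
    addr (pos n p) = addr (pos n q) ↔ p = q :=
  ⟨fun h => eq_of_pos_eq (hM.addr_injective h) hp hp' hq hq', fun h => by rw [h]⟩

/-- An end can advance exactly when its next semiblock differs from the left far neighbor of the
other end, by `farLeft_eq_pos_iff` and its mirror image. The limits `lx`, `ly` need be genuine only
where an admissible advance could meet them, which permits null limits when a cut is known. The loop
terminates because the distance to `X` and `Y` decreases. -/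
theorem runs_extendProg (hM : IsBaseRep Φ name addr m head) {x₀ y₀ X Y : ℕ} {lx ly : ℕ}
    (h0 : Φ.Apart x₀ y₀)
    (hX : ∀ y < Y, Φ.lim X ≤ y → lx = addr (pos n X))
    (hY : ∀ x < X, Φ.lim Y ≤ x + n → ly = addr (pos n Y))
    {x y : ℕ} (hE : Φ.Ext x₀ y₀ x y) (hx : x < X) (hy : y < Y) {s : State}
    (hm : s.mem = m) (hsx : ∀ p, x ≤ p → p < X → nextPtr s (addr (pos n p)) = addr (pos n (p + 1)))
    (hsy : ∀ p, y ≤ p → p < Y → nextPtr s (addr (pos n p)) = addr (pos n (p + 1)))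
    (h4 : s.reg 4 = addr (pos n x)) (h5 : s.reg 5 = addr (pos n y)) (h6 : s.reg 6 = lx)
    (h7 : s.reg 7 = ly) (h8 : s.reg 8 = 0) (h21 : s.reg 21 = 0) (h30 : s.reg 30 = 0) :
    Runs extendProg s fun t s' => ∃ x' y', Φ.Ext x₀ y₀ x' y' ∧ x ≤ x' ∧ x' < X ∧ y ≤ y' ∧ y' < Y ∧
      t ≤ 40 * (x' - x + (y' - y) + 1) ∧ s'.mem = m ∧ s'.out = s.out ∧
      s'.reg 4 = addr (pos n x') ∧ s'.reg 5 = addr (pos n y') ∧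
      (∀ r, r < 4 ∨ (11 ≤ r ∧ r < 19) ∨ 30 ≤ r → s'.reg r = s.reg r) ∧
      ((s'.reg 21 = 0 ∧ y' < Φ.lim (x' + 1) ∧ x' + n < Φ.lim (y' + 1)) ∨
        (s'.reg 21 = 1 ∧ ((Φ.lim (y' + 1) ≤ x' + n ∧ addr (pos n (y' + 1)) = ly) ∨
          (Φ.lim (x' + 1) ≤ y' ∧ addr (pos n (x' + 1)) = lx)))) := by
  obtain ⟨k, hk⟩ : ∃ k, X - x + (Y - y) = k := ⟨_, rfl⟩
  induction k using Nat.strong_induction_on generalizing x y s with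
  | _ k ih =>
  have ha := hE.apart h0
  have hxy := Φ.lt_lim x
  have hyx := Φ.lt_lim y
  obtain ⟨ha1, ha2⟩ := id ha
  have hf1 := Φ.farLeft_eq_pos_iff (x := x) (y := y) (by omega) (by omega) (Or.inr ha2)
  have hf2 := Φ.farLeft_pos_eq_pos_succ_iff (x := x) (y := y) (by omega) (by omega) ha1
  have hny := hsy y le_rfl hy
  have hnx := hsx x le_rfl hx
  -- Once register `8` is set, only the final evaluation of the loop test is left.
  have hdone : ∀ s' : State, s'.reg 8 = 1 → s'.reg 30 = 0 → ∀ Q : ℕ → State → Prop, Q 1 s' →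
      Runs extendProg s' Q := by
    intro s' h1 h2 Q hQ
    refine runs_while (fun h => ?_) (fun _ => hQ)
    simp [Test.Holds, h1, h2] at h
  refine runs_while (fun _ => ?_) (fun h => absurd (by simp [Test.Holds, h8, h30]) h)
  refine runs_seq (runs_succProg (by norm_num) (runs_seq (runs_farLeftProg (runs_ite
    (fun hb1 => runs_ite (fun hb2 => runs_seq (runs_const (runs_const ?_)))
      (fun hb2 => runs_add ?_))
    (fun hb1 => runs_seq (runs_succProg (by norm_num) (runs_seq (runs_farLeftProg (runs_ite
      (fun hb2 => runs_ite (fun hb3 => runs_seq (runs_const (runs_const ?_)))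
        (fun hb3 => runs_add ?_))
      (fun hb2 => runs_const ?_))))))))))
  · simp [Test.Holds, h4, h5, h7, hm, mem_farLeft hM, hny, hM.addr_injective.eq_iff] at hb1 hb2
    refine hdone _ (by simp) (by simpa using h30) _ ⟨x, y, hE, le_rfl, hx, le_rfl, hy, ?_⟩
    refine ⟨by omega, by simpa using hm, rfl, by simpa using h4, by simpa using h5, ?_, ?_⟩
    · intro r hr
      have : r ≠ 8 ∧ r ≠ 9 ∧ r ≠ 10 ∧ r ≠ 20 ∧ r ≠ 21 := by omega
      simp [this]
    · exact Or.inr ⟨by simp, Or.inl ⟨Nat.le_of_not_lt fun h => hb1 (hf1.mpr h).symm, hb2⟩⟩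
  · simp [Test.Holds, h4, h5, h7, hm, mem_farLeft hM, hny, hM.addr_injective.eq_iff] at hb1 hb2
    have hl : Φ.lim (y + 1) ≤ x + n := Nat.le_of_not_lt fun h => hb1 (hf1.mpr h).symm
    have hy' : y + 1 < Y := by
      by_contra hc
      obtain rfl : y + 1 = Y := by omega
      exact hb2 (hY x hx hl).symm
    refine (ih _ (by omega) (hE.right hl) hx hy' ?_ ?_ ?_ ?_ ?_ ?_ ?_ ?_ ?_ ?_ rfl).mono ?_
    · simpa using hm
    · simpa using hsx
    · simpa using fun p hp => hsy p (by omega)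
    · simpa using h4
    · simp [hny, h5]
    · simpa using h6
    · simpa using h7
    · simpa using h8
    · simpa using h21
    · simpa using h30
    · rintro t s' ⟨x', y', i1, i2, i3, i4, i5, i6, i7, i8, i9, i10, i11, i12⟩
      refine ⟨x', y', i1, i2, i3, by omega, i5, by omega, i7, i8, i9, i10, ?_, i12⟩
      intro r hr
      have : r ≠ 5 ∧ r ≠ 9 ∧ r ≠ 10 ∧ r ≠ 20 := by omega
      simp [i11 r hr, this]
  · simp [Test.Holds, h4, h5, h6, hm, mem_farLeft hM, hny, hnx,
      hM.addr_injective.eq_iff] at hb1 hb2 hb3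
    refine hdone _ (by simp) (by simpa using h30) _ ⟨x, y, hE, le_rfl, hx, le_rfl, hy, ?_⟩
    refine ⟨by omega, by simpa using hm, rfl, by simpa using h4, by simpa using h5, ?_, ?_⟩
    · intro r hr
      have : r ≠ 8 ∧ r ≠ 9 ∧ r ≠ 10 ∧ r ≠ 20 ∧ r ≠ 21 := by omega
      simp [this]
    · exact Or.inr ⟨by simp, Or.inr ⟨Nat.le_of_not_lt fun h => hb2 (hf2.mpr h).symm, hb3⟩⟩
  · simp [Test.Holds, h4, h5, h6, hm, mem_farLeft hM, hny, hnx,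
      hM.addr_injective.eq_iff] at hb1 hb2 hb3
    have hl : Φ.lim (x + 1) ≤ y := Nat.le_of_not_lt fun h => hb2 (hf2.mpr h).symm
    have hx' : x + 1 < X := by
      by_contra hc
      obtain rfl : x + 1 = X := by omega
      exact hb3 (hX y hy hl).symm
    refine (ih _ (by omega) (hE.left hl) hx' hy ?_ ?_ ?_ ?_ ?_ ?_ ?_ ?_ ?_ ?_ rfl).mono ?_
    · simpa using hm
    · simpa using fun p hp => hsx p (by omega)
    · simpa using hsy
    · simp [hnx, h4]
    · simpa using h5
    · simpa using h6
    · simpa using h7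
    · simpa using h8
    · simpa using h21
    · simpa using h30
    · rintro t s' ⟨x', y', i1, i2, i3, i4, i5, i6, i7, i8, i9, i10, i11, i12⟩
      refine ⟨x', y', i1, by omega, i3, i4, i5, by omega, i7, i8, i9, i10, ?_, i12⟩
      intro r hr
      have : r ≠ 4 ∧ r ≠ 9 ∧ r ≠ 10 ∧ r ≠ 20 := by omega
      simp [i11 r hr, this]
  · simp [Test.Holds, h4, h5, hm, mem_farLeft hM, hny, hnx,
      hM.addr_injective.eq_iff] at hb1 hb2
    refine hdone _ (by simp) (by simpa using h30) _ ⟨x, y, hE, le_rfl, hx, le_rfl, hy, ?_⟩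
    refine ⟨by omega, by simpa using hm, rfl, by simpa using h4, by simpa using h5, ?_, ?_⟩
    · intro r hr
      have : r ≠ 8 ∧ r ≠ 9 ∧ r ≠ 10 ∧ r ≠ 20 := by omega
      simp [this]
    · exact Or.inl ⟨by simpa using h21, hf2.mp hb2.symm, hf1.mp hb1.symm⟩

end correctness

/-! ### Listing the co-contig pairs of a cut. -/

/-- Advances `x`, and sets `flag` when the semiblock in `l` is met. -/
def advanceProg (x l flag : ℕ) : Prog :=
  .seq (succProg 9 x) (.seq (.add x 9 0)
    (.ite (.eq x l) (.const flag 1) (.add flag flag 0)))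

/-- Writes the pair of the semiblock in `12` and the empty range. -/
def leftProg : Prog :=
  .seq (.emit 12) (.seq (.emit 12) (.seq (.emit 30) (.seq (.emit 30) (advanceProg 12 15 16))))

/-- Writes the pair of the empty range and the semiblock in `13`. -/
def rightProg : Prog :=
  .seq (.emit 30) (.seq (.emit 30) (.seq (.emit 13) (.seq (.emit 13) (advanceProg 13 14 17))))

/-- Writes the pair of nonempty ranges that begin in `12` and `13`. -/
def bothProg : Prog :=
  .seq (.add 4 12 0) (.seq (.add 5 13 0) (.seq (.const 6 0) (.seq (.const 7 0)
    (.seq (.const 8 0) (.seq (.const 21 0) (.seq extendProg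
      (.seq (.emit 12) (.seq (.emit 4) (.seq (.emit 13) (.seq (.emit 5)
        (.seq (.add 12 4 0) (.seq (advanceProg 12 15 16)
          (.seq (.add 13 5 0) (advanceProg 13 14 17))))))))))))))

/-- Writes the co-contig pairs for a cut into two cliques, which begin in `14` and `15`.  The
registers `12` and `13` hold the first semiblocks of the cliques that remain to be treated, and `16`
and `17` tell whether there is none. -/
def pairsProg : Prog :=
  .while (.eq 18 30)
    (.ite (.eq 16 30)
      (.seq (limProg 9 12) (.seq (farLeftProg 10 12) (.ite (.eq 9 10) leftProg
        (.seq (limProg 9 13) (.seq (farLeftProg 10 13) (.ite (.eq 9 10) rightProg bothProg))))))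
      (.ite (.eq 17 30) rightProg (.const 18 1)))

theorem runs_advanceProg {s : State} {Q : ℕ → State → Prop} {x l flag : ℕ} (hx : x ≠ 20)
    (hl : l ≠ x) (hl9 : l ≠ 9) (hl20 : l ≠ 20) (hf : flag ≠ x) (hf9 : flag ≠ 9)
    (hf20 : flag ≠ 20)
    (h : Q 7 ((((s.set 20 (s.mem (s.reg x + 2))).set 9 (nextPtr s (s.reg x))).set x
      (nextPtr s (s.reg x))).set flag
        (if nextPtr s (s.reg x) = s.reg l then 1 else s.reg flag))) :
    Runs (advanceProg x l flag) s Q := by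
  refine Runs.of_le (runs_seq (runs_succProg hx (runs_seq (runs_add (runs_ite
    (fun hb => runs_const ?_) (fun hb => runs_add ?_)))))) h
  · simp [Test.Holds, hl, hl9, hl20] at hb
    simp [hb]
  · simp [Test.Holds, hl, hl9, hl20] at hb
    simp [hb, hf, hf9, hf20]

theorem pairsOutput_concat {n : ℕ} (addr : Fin n → ℕ) (L : List (Rng n × Rng n))
    (p : Rng n × Rng n) : pairsOutput addr (L ++ [p]) =
      pairsOutput addr L ++ (p.1.pointers addr ++ p.2.pointers addr) := by
  simp [pairsOutput]

variable {V : Type*} {n : ℕ} [NeZero n] {Φ : RoundRep V n} {name : V → ℕ} {addr : Fin n → ℕ}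
  {m : ℕ → ℕ} {head : ℕ}

/-- The state in which the ranges `[S, a)` and `[T, b)` have been treated. -/
structure PairsInv (Φ : RoundRep V n) (addr : Fin n → ℕ) (m : ℕ → ℕ) (S T a b : ℕ)
    (L : List (Rng n × Rng n)) (s : State) : Prop where
  ordering : Φ.IsPartialOrdering S T a b L
  mem : s.mem = m
  out : s.out = 1 :: pairsOutput addr L
  next : ∀ p, nextPtr s (addr (pos n p)) = addr (pos n (p + 1))
  reg12 : s.reg 12 = addr (pos n a)
  reg13 : s.reg 13 = addr (pos n b)
  reg14 : s.reg 14 = addr (pos n S)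
  reg15 : s.reg 15 = addr (pos n T)
  reg16 : s.reg 16 = if a = T then 1 else 0
  reg17 : s.reg 17 = if b = S + n then 1 else 0
  reg18 : s.reg 18 = 0
  reg30 : s.reg 30 = 0

theorem PairsInv.set {S T a b : ℕ} {L : List (Rng n × Rng n)} {s : State}
    (h : PairsInv Φ addr m S T a b L s) {r : ℕ} (hr : (4 ≤ r ∧ r < 12) ∨ (19 ≤ r ∧ r < 30))
    (v : ℕ) : PairsInv Φ addr m S T a b L (s.set r v) := by
  have hs : ∀ k, ((12 ≤ k ∧ k < 19) ∨ k = 30) → (s.set r v).reg k = s.reg k := by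
    intro k hk
    rw [State.set_reg, if_neg (by omega)]
  exact
    { ordering := h.ordering
      mem := h.mem
      out := h.out
      next := by rw [nextPtr_set s v (by omega)]; exact h.next
      reg12 := by rw [hs _ (by omega), h.reg12]
      reg13 := by rw [hs _ (by omega), h.reg13]
      reg14 := by rw [hs _ (by omega), h.reg14]
      reg15 := by rw [hs _ (by omega), h.reg15]
      reg16 := by rw [hs _ (by omega), h.reg16]
      reg17 := by rw [hs _ (by omega), h.reg17]
      reg18 := by rw [hs _ (by omega), h.reg18]
      reg30 := by rw [hs _ (by omega), h.reg30] }

section steps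

variable {S T a b : ℕ} {L : List (Rng n × Rng n)} {s : State}

theorem runs_leftProg (hM : IsBaseRep Φ name addr m head) (hc : Φ.IsCut S T)
    (h : PairsInv Φ addr m S T a b L s) (ha : a < T) (hu : a + n < Φ.lim (Φ.lim a)) :
    Runs leftProg s fun t s' => t ≤ 11 ∧
      PairsInv Φ addr m S T (a + 1) b (L ++ [(some (pos n a, pos n a), none)]) s' := by
  refine runs_seq (runs_emit (runs_seq (runs_emit (runs_seq (runs_emit (runs_seq (runs_emit
    (runs_advanceProg (by norm_num) (by norm_num) (by norm_num) (by norm_num)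
      (by norm_num) (by norm_num) (by norm_num) ⟨le_rfl, ?_⟩))))))))
  have h1 := h.ordering.le_left
  have h2 := hc.le
  -- Ends are compared in the window `(S, S + n]`, where `T` and `S + n` have distinct addresses
  -- unless they coincide.
  have h3 := ptr_eq_iff hM (k := S + 1) (p := a + 1) (q := T) (by omega) (by omega) (by omega)
    (by omega)
  exact
    { ordering := h.ordering.append_left hc ha hu
      mem := by simpa using h.mem
      out := by simp [h.out, pairsOutput_concat, Rng.pointers, h.reg12, h.reg30]
      next := by simpa using h.next
      reg12 := by simp [h.reg12, h.next]
      reg13 := by simpa using h.reg13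
      reg14 := by simpa using h.reg14
      reg15 := by simpa using h.reg15
      reg16 := by simp [h.reg12, h.next, h.reg15, h3, h.reg16, ha.ne]
      reg17 := by simpa using h.reg17
      reg18 := by simpa using h.reg18
      reg30 := by simpa using h.reg30 }

theorem runs_rightProg (hM : IsBaseRep Φ name addr m head) (hc : Φ.IsCut S T)
    (h : PairsInv Φ addr m S T a b L s) (hb : b < S + n) (hu : b + n < Φ.lim (Φ.lim b)) :
    Runs rightProg s fun t s' => t ≤ 11 ∧
      PairsInv Φ addr m S T a (b + 1) (L ++ [(none, some (pos n b, pos n b))]) s' := by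
  refine runs_seq (runs_emit (runs_seq (runs_emit (runs_seq (runs_emit (runs_seq (runs_emit
    (runs_advanceProg (by norm_num) (by norm_num) (by norm_num) (by norm_num)
      (by norm_num) (by norm_num) (by norm_num) ⟨le_rfl, ?_⟩))))))))
  have h1 := h.ordering.le_right
  have h2 := hc.lt
  have h3 := ptr_eq_iff hM (k := S + 1) (p := b + 1) (q := S + n) (by omega) (by omega)
    (by have := NeZero.pos n; omega) (by omega)
  rw [pos_add_self] at h3
  exact
    { ordering := h.ordering.append_right hc hb hu
      mem := by simpa using h.mem
      out := by simp [h.out, pairsOutput_concat, Rng.pointers, h.reg13, h.reg30]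
      next := by simpa using h.next
      reg12 := by simpa using h.reg12
      reg13 := by simp [h.reg13, h.next]
      reg14 := by simpa using h.reg14
      reg15 := by simpa using h.reg15
      reg16 := by simpa using h.reg16
      reg17 := by simp [h.reg13, h.next, h.reg14, h3, h.reg17, hb.ne]
      reg18 := by simpa using h.reg18
      reg30 := by simpa using h.reg30 }

theorem runs_bothProg (hM : IsBaseRep Φ name addr m head) (hc : Φ.IsCut S T)
    (h : PairsInv Φ addr m S T a b L s) (ha : a < T) (hb : b < S + n) (hab : Φ.Apart a b) :
    Runs bothProg s fun t s' => ∃ a' b' L', a < a' ∧ a' ≤ T ∧ b < b' ∧ b' ≤ S + n ∧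
      t ≤ 40 * (a' - a + (b' - b)) ∧ PairsInv Φ addr m S T a' b' L' s' := by
  have h1 := h.ordering.le_left
  have h2 := h.ordering.le_right
  have h3 := hc.lt
  have h4 := hc.le
  refine runs_seq (runs_add (runs_seq (runs_add (runs_seq (runs_const (runs_seq (runs_const
    (runs_seq (runs_const (runs_seq (runs_const (runs_seq ?_))))))))))))
  refine Runs.mono (runs_extendProg hM (x₀ := a) (y₀ := b) (X := T) (Y := S + n) (lx := 0)
    (ly := 0) (x := a) (y := b) hab ?_ ?_ .refl ha hb ?_ ?_ ?_ ?_ ?_ ?_ ?_ ?_ ?_ ?_) ?_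
  -- Both limit conditions are vacuous: the cut inequalities rule out an advance to `T` or to `S +
  -- n`.
  · intro y hy hl
    have := hc.right
    omega
  · intro x hx hl
    have := hc.left
    rw [Φ.lim_add_self] at hl
    omega
  · simpa using h.mem
  · simpa using fun p _ _ => h.next p
  · simpa using fun p _ _ => h.next p
  · simp [h.reg12]
  · simp [h.reg13]
  · simp
  · simp
  · simp
  · simp
  · simp [h.reg30]
  rintro t s' ⟨x, y, hE, hax, hx, hby, hy, ht, hm, ho, h5, h6, hfr, hend⟩
  -- An exit through a limit would require a record at the null address.
  obtain ⟨-, hx', hy'⟩ := hend.resolve_right (by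
    rintro ⟨-, ⟨-, h7⟩ | ⟨-, h7⟩⟩ <;> exact hM.addr_ne_zero _ h7)
  simp only [State.set_reg] at hfr
  have hnext : nextPtr s' = nextPtr s := by
    refine nextPtr_congr (hm.trans h.mem.symm) ?_ ?_ ?_ <;>
      · rw [hfr _ (by omega)]; simp
  have r12 : s'.reg 12 = addr (pos n a) := by rw [hfr _ (by omega)]; simpa using h.reg12
  have r13 : s'.reg 13 = addr (pos n b) := by rw [hfr _ (by omega)]; simpa using h.reg13
  have r14 : s'.reg 14 = addr (pos n S) := by rw [hfr _ (by omega)]; simpa using h.reg14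
  have r15 : s'.reg 15 = addr (pos n T) := by rw [hfr _ (by omega)]; simpa using h.reg15
  have r16 : s'.reg 16 = 0 := by rw [hfr _ (by omega)]; simpa [ha.ne] using h.reg16
  have r17 : s'.reg 17 = 0 := by rw [hfr _ (by omega)]; simpa [hb.ne] using h.reg17
  have r18 : s'.reg 18 = 0 := by rw [hfr _ (by omega)]; simpa using h.reg18
  have r30 : s'.reg 30 = 0 := by rw [hfr _ (by omega)]; simpa using h.reg30
  have hn : ∀ p, nextPtr s' (addr (pos n p)) = addr (pos n (p + 1)) := by
    intro p; rw [hnext, h.next]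
  have e1 := ptr_eq_iff hM (k := S + 1) (p := x + 1) (q := T) (by omega) (by omega) (by omega)
    (by omega)
  have e2 := ptr_eq_iff hM (k := S + 1) (p := y + 1) (q := S + n) (by omega) (by omega)
    (by have := NeZero.pos n; omega) (by omega)
  rw [pos_add_self] at e2
  refine runs_seq (runs_emit (runs_seq (runs_emit (runs_seq (runs_emit (runs_seq (runs_emit
    (runs_seq (runs_add (runs_seq
    (runs_advanceProg (by norm_num) (by norm_num) (by norm_num) (by norm_num)
      (by norm_num) (by norm_num) (by norm_num) (runs_seq (runs_add
    (runs_advanceProg (by norm_num) (by norm_num) (by norm_num) (by norm_num)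
      (by norm_num) (by norm_num) (by norm_num)
        ⟨x + 1, y + 1, L ++ [(some (pos n a, pos n x), some (pos n b, pos n y))], by omega, by omega, by omega, by omega, by omega, ?_⟩))))))))))))))
  exact
    { ordering := h.ordering.append_ext hc hab hE hx hy hx' hy'
      mem := by simpa using hm
      out := by simp [ho, h.out, pairsOutput_concat, Rng.pointers, r12, r13, h5, h6]
      next := by simpa using hn
      reg12 := by simp [h5, hn]
      reg13 := by simp [h6, hn]
      reg14 := by simp [r14]
      reg15 := by simp [r15]
      reg16 := by simp [h5, hn, r15, e1, r16]
      reg17 := by simp [h6, hn, r14, e2, r17]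
      reg18 := by simp [r18]
      reg30 := by simp [r30] }

/-- Each round treats at least one new semiblock at a cost proportional to the number treated, so
the remaining length bounds the time. -/
theorem runs_pairsProg (hM : IsBaseRep Φ name addr m head) (hc : Φ.IsCut S T)
    (h : PairsInv Φ addr m S T a b L s) :
    Runs pairsProg s fun t s' => t ≤ 100 * (T - a + (S + n - b) + 1) ∧ s'.mem = m ∧
      ∃ L, Φ.IsNaturalOrdering L ∧ s'.out = 1 :: pairsOutput addr L := by
  obtain ⟨k, hk⟩ : ∃ k, T - a + (S + n - b) = k := ⟨_, rfl⟩
  induction k using Nat.strong_induction_on generalizing a b L s with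
  | _ k ih =>
  have haT := h.ordering.left_le
  have hbS := h.ordering.right_le
  have ih' : ∀ {a' b' L' s' d}, PairsInv Φ addr m S T a' b' L' s' → a ≤ a' → b ≤ b' →
      a' ≤ T → b' ≤ S + n → a + b < a' + b' → d ≤ 100 * (a' - a + (b' - b)) →
      Runs pairsProg s' fun t s' => d + t ≤ 100 * (T - a + (S + n - b) + 1) ∧ s'.mem = m ∧
        ∃ L, Φ.IsNaturalOrdering L ∧ s'.out = 1 :: pairsOutput addr L := by
    intro a' b' L' s' d h' h1 h2 h3 h4 h5 h6
    exact (ih _ (by omega) h' rfl).mono fun t s'' h => ⟨by omega, h.2⟩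
  have hleft : a < T → Φ.farLeft (pos n a) = pos n (Φ.lim a) → ∀ s' d,
      PairsInv Φ addr m S T a b L s' → d ≤ 60 →
      Runs leftProg s' fun t s' => Runs pairsProg s' fun t' s'' =>
        d + t + t' ≤ 100 * (T - a + (S + n - b) + 1) ∧ s''.mem = m ∧
        ∃ L, Φ.IsNaturalOrdering L ∧ s''.out = 1 :: pairsOutput addr L := by
    intro ha hu s' d h' hd
    refine (runs_leftProg hM hc h' ha ((Φ.farLeft_pos_eq_pos_lim_iff a).mp hu)).mono ?_
    rintro t s'' ⟨h1, h2⟩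
    exact ih' h2 (by omega) le_rfl ha hbS (by omega) (by omega)
  have hright : b < S + n → Φ.farLeft (pos n b) = pos n (Φ.lim b) → ∀ s' d,
      PairsInv Φ addr m S T a b L s' → d ≤ 60 →
      Runs rightProg s' fun t s' => Runs pairsProg s' fun t' s'' =>
        d + t + t' ≤ 100 * (T - a + (S + n - b) + 1) ∧ s''.mem = m ∧
        ∃ L, Φ.IsNaturalOrdering L ∧ s''.out = 1 :: pairsOutput addr L := by
    intro hb hu s' d h' hd
    refine (runs_rightProg hM hc h' hb ((Φ.farLeft_pos_eq_pos_lim_iff b).mp hu)).mono ?_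
    rintro t s'' ⟨h1, h2⟩
    exact ih' h2 le_rfl (by omega) haT hb (by omega) (by omega)
  have hlim : ∀ p, nextPtr s (addr (Φ.far (pos n p))) = addr (pos n (Φ.lim p)) := by
    intro p
    have := Φ.lt_lim p
    rw [← Φ.pos_lim_sub_one, h.next, Nat.sub_add_cancel (by omega)]
  refine runs_while (fun _ => ?_)
    (fun h' => absurd (by simp [Test.Holds, h.reg18, h.reg30]) h')
  refine runs_ite (fun h16 => ?_) (fun h16 => ?_)
  · have ha : a < T := by
      refine lt_of_le_of_ne haT fun e => ?_
      simp [Test.Holds, h.reg16, h.reg30, e] at h16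
    refine runs_seq (runs_limProg (runs_seq (runs_farLeftProg (runs_ite (fun hu => ?_)
      (fun hu => runs_seq (runs_limProg (runs_seq (runs_farLeftProg (runs_ite (fun hu' => ?_)
        (fun hu' => ?_))))))))))
    · simp [Test.Holds, h.reg12, h.mem, mem_far hM, mem_farLeft hM, hlim,
        hM.addr_injective.eq_iff] at hu
      refine (hleft ha hu.symm _ 60 ?_ (by norm_num)).mono fun t s' h => ?_
      · iterate 4 refine PairsInv.set ?_ (by omega) _
        exact h
      · refine h.mono fun t' s'' h => ⟨by omega, h.2⟩
    all_goals
      simp [Test.Holds, h.reg12, h.reg13, h.mem, mem_far hM, mem_farLeft hM, hlim,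
        hM.addr_injective.eq_iff] at hu hu'
      have hua : Φ.lim (Φ.lim a) ≤ a + n :=
        Nat.le_of_not_lt fun h => hu ((Φ.farLeft_pos_eq_pos_lim_iff a).mpr h).symm
      -- The non-neighbour of `a` shows that the second clique is not exhausted, so `13` may be used
      -- without testing `17`.
      obtain ⟨j, hj, hj', -⟩ := h.ordering.exists_apart_left hc ha hua
      have hb : b < S + n := by omega
    · refine (hright hb hu'.symm _ 60 ?_ (by norm_num)).mono fun t s' h => ?_
      · iterate 8 refine PairsInv.set ?_ (by omega) _
        exact h
      · refine h.mono fun t' s'' h => ⟨by omega, h.2⟩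
    · have hub : Φ.lim (Φ.lim b) ≤ b + n :=
        Nat.le_of_not_lt fun h => hu' ((Φ.farLeft_pos_eq_pos_lim_iff b).mpr h).symm
      refine (runs_bothProg hM hc (a := a) (b := b) (L := L) ?_ ha hb
        (h.ordering.apart hc ha hb hua hub)).mono ?_
      · iterate 8 refine PairsInv.set ?_ (by omega) _
        exact h
      · rintro t s' ⟨a', b', L', h1, h2, h3, h4, h5, h6⟩
        refine (ih' (d := 100 * (a' - a + (b' - b))) h6 h1.le h3.le h2 h4 (by omega) le_rfl).mono
          fun t' s'' h => ⟨by omega, h.2⟩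
  · obtain rfl : a = T := by
      by_contra hne
      simp [Test.Holds, h.reg16, h.reg30, hne] at h16
    refine runs_ite (fun h17 => ?_) (fun h17 => ?_)
    · have hb : b < S + n := by
        refine lt_of_le_of_ne hbS fun e => ?_
        simp [Test.Holds, h.reg17, h.reg30, e] at h17
      -- The first clique is exhausted, so `b` has no possible non-neighbour left.
      have hu : b + n < Φ.lim (Φ.lim b) := by
        by_contra hu
        obtain ⟨i, h1, h2, -⟩ := h.ordering.exists_apart_right hc hb (Nat.le_of_not_lt hu)
        omega
      refine (hright hb ((Φ.farLeft_pos_eq_pos_lim_iff b).mpr hu) _ 3 h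
        (by norm_num)).mono fun t s' h => ?_
      refine h.mono fun t' s'' h => ⟨by omega, h.2⟩
    · obtain rfl : b = S + n := by
        by_contra hne
        simp [Test.Holds, h.reg17, h.reg30, hne] at h17
      refine runs_const (runs_while (fun h' => ?_) (fun _ => ?_))
      · simp [Test.Holds, h.reg30] at h'
      · exact ⟨by omega, h.mem, L, h.ordering.isNaturalOrdering, h.out⟩

end steps

/-! ### Finding a cut, and the whole program. -/

/-- Reports that the graph is co-bipartite and writes the co-contig pairs for the cut into two
cliques that begin in `14` and `15`. -/
def finishProg : Prog :=
  .seq (.const 9 1) (.seq (.emit 9) (.seq (.add 12 14 0) (.seq (.add 13 15 0)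
    (.seq (.const 16 0) (.seq (.const 18 0)
      (.seq (.ite (.eq 14 15) (.const 17 1) (.const 17 0)) pairsProg))))))

/-- Searches for a cut into two cliques, starting from the semiblock in `4`. -/
def searchProg : Prog :=
  .seq (limProg 6 4) (.ite (.eq 6 30) (.emit 30)
    (.seq (.add 5 6 0) (.seq (farLeftProg 9 4) (.ite (.eq 9 6)
      (.seq (.add 14 4 0) (.seq (.add 15 6 0) finishProg))
      (.seq (limProg 7 6) (.ite (.eq 7 30) (.emit 30)
        (.seq (.const 8 0) (.seq (.const 21 0) (.seq extendProg (.ite (.eq 21 30)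
          (.seq (succProg 14 4) (.seq (succProg 15 5) finishProg))
          (.emit 30)))))))))))

/-- Follows three left far pointers. -/
def leftEndProg (x : ℕ) : Prog :=
  .seq (farLeftProg x x) (.seq (farLeftProg x x) (farLeftProg x x))

/-- The whole program. -/
def mainProg : Prog :=
  .seq (.load 4 0 0) (.seq (.load 9 0 1) (.seq (leftEndProg 4) (.seq (.load 10 4 1)
    (.ite (.eq 9 30)
      (.ite (.eq 10 4) (.seq (.add 3 4 0) searchProg) searchProg)
      (.seq (.load 5 9 0) (.seq (.load 9 9 1) (.ite (.eq 9 30)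
        (.ite (.eq 10 4)
          (.seq (leftEndProg 5) (.seq (.load 10 5 1) (.ite (.eq 10 5)
            (.seq (.load 11 4 6) (.seq (.load 11 11 0) (.seq (.load 10 11 2) (.ite (.eq 10 11)
              (.seq (.add 1 11 0) (.seq (.add 2 5 0) (.seq (.add 3 4 0) searchProg)))
              (.emit 30)))))
            (.emit 30))))
          (.emit 30))
        (.emit 30))))))))

/-- The program has halted in time, with unchanged memory and the correct output. -/
def Correct (Φ : RoundRep V n) (addr : Fin n → ℕ) (m : ℕ → ℕ) (c t : ℕ) (s : State) : Prop :=
  t ≤ c * (Φ.graph.maxDegree + 1) ∧ s.mem = m ∧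
    ((¬ IsCoBipartite Φ.graph ∧ s.out = [0]) ∨
      (IsCoBipartite Φ.graph ∧
        ∃ L : List (Rng n × Rng n), Φ.IsNaturalOrdering L ∧ s.out = 1 :: pairsOutput addr L))

theorem runs_fail {s : State} {c : ℕ → ℕ} {C : ℕ} (hc : c 1 ≤ C) (hm : s.mem = m)
    (ho : s.out = []) (h30 : s.reg 30 = 0) (hb : ¬ IsCoBipartite Φ.graph) :
    Runs (.emit 30) s fun t s' => Correct Φ addr m C (c t) s' := by
  refine runs_emit ⟨?_, hm, Or.inl ⟨hb, by simp [ho, h30]⟩⟩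
  nlinarith [Nat.zero_le (C * Φ.graph.maxDegree)]

theorem runs_finishProg (hM : IsBaseRep Φ name addr m head) {S T : ℕ} (hc : Φ.IsCut S T)
    {s : State} (hm : s.mem = m) (ho : s.out = [])
    (hn : ∀ p, nextPtr s (addr (pos n p)) = addr (pos n (p + 1)))
    (h14 : s.reg 14 = addr (pos n S)) (h15 : s.reg 15 = addr (pos n T)) (h30 : s.reg 30 = 0) :
    Runs finishProg s fun t s' => Correct Φ addr m 400 t s' := by
  have hle := hc.le
  have hlt := hc.lt
  have key : ∀ (s' : State) (d : ℕ), d ≤ 50 → PairsInv Φ addr m S T S T [] s' →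
      Runs pairsProg s' fun t s' => Correct Φ addr m 400 (d + t) s' := by
    intro s' d hd h
    refine (runs_pairsProg hM hc h).mono ?_
    rintro t s'' ⟨h1, h2, h3⟩
    refine ⟨?_, h2, Or.inr ⟨hc.isCoBipartite, h3⟩⟩
    have := hc.le_maxDegree
    omega
  -- The second clique is empty exactly when `T = S + n`, that is, when both cliques begin at the
  -- same record.
  have e := ptr_eq_iff hM (k := S + 1) (p := S + n) (q := T)
    (by have := NeZero.pos n; omega) (by omega) (by omega) (by omega)
  rw [pos_add_self] at e
  refine runs_seq (runs_const (runs_seq (runs_emit (runs_seq (runs_add (runs_seq (runs_add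
    (runs_seq (runs_const (runs_seq (runs_const (runs_seq (runs_ite (fun hb => runs_const ?_)
      (fun hb => runs_const ?_))))))))))))))
  all_goals
    simp [Test.Holds, h14, h15, e] at hb
    refine (key _ 40 (by norm_num) ?_).mono fun t s' h => ⟨by have := h.1; omega, h.2⟩
    exact
      { ordering := hc.isPartialOrdering_nil
        mem := by simpa using hm
        out := by simp [ho, pairsOutput]
        next := by simpa using hn
        reg12 := by simp [h14]
        reg13 := by simp [h15]
        reg14 := by simp [h14]
        reg15 := by simp [h15]
        reg16 := by simp [hlt.ne]
        reg17 := by simp [hb, Ne.symm]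
        reg18 := by simp
        reg30 := by simp [h30] }

/-- Successors need not be known in advance: by `hn` one may be null at a right end, but by `hb`
only if the graph is not co-bipartite. A null successor met by `limProg` is therefore a refutation,
while a cut, once found, makes all successors valid for the listing phase. -/
theorem runs_searchProg (hM : IsBaseRep Φ name addr m head) {p₀ : ℕ} {s : State}
    (hm : s.mem = m) (ho : s.out = [])
    (hn : ∀ p, nextPtr s (addr (pos n p)) = addr (pos n (p + 1)) ∨
      (nextPtr s (addr (pos n p)) = 0 ∧ Φ.lim p = p + 1))
    (hb : IsCoBipartite Φ.graph → ∀ p, nextPtr s (addr (pos n p)) = addr (pos n (p + 1)))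
    (h4 : s.reg 4 = addr (pos n p₀)) (h30 : s.reg 30 = 0) :
    Runs searchProg s fun t s' => Correct Φ addr m 600 t s' := by
  have hlt := Φ.lt_lim p₀
  have hlt' := Φ.lt_lim (Φ.lim p₀)
  have hle := Φ.lim_le p₀
  have hle' := Φ.lim_le (Φ.lim p₀)
  -- the next semiblock is found before a position that is reached without passing an end
  have hval : ∀ q, nextPtr s (addr (Φ.far (pos n q))) ≠ 0 → ∀ p, q ≤ p → p < Φ.lim q →
      nextPtr s (addr (pos n p)) = addr (pos n (p + 1)) := by
    intro q hq p h1 h2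
    refine (hn p).resolve_right ?_
    rintro ⟨h3, h4⟩
    have h5 := Φ.lim_mono h1
    refine hq ?_
    rw [← Φ.pos_lim_sub_one, show Φ.lim q - 1 = p by omega, h3]
  have hlim : ∀ q, nextPtr s (addr (Φ.far (pos n q))) ≠ 0 →
      nextPtr s (addr (Φ.far (pos n q))) = addr (pos n (Φ.lim q)) := by
    intro q hq
    have := Φ.lt_lim q
    have h := hval q hq (Φ.lim q - 1) (by omega) (by omega)
    rwa [Φ.pos_lim_sub_one, Nat.sub_add_cancel (by omega)] at h
  have hzero : ∀ q, nextPtr s (addr (Φ.far (pos n q))) = 0 → ¬ IsCoBipartite Φ.graph := by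
    intro q hq h
    rw [← Φ.pos_lim_sub_one, hb h] at hq
    exact hM.addr_ne_zero _ hq
  refine runs_seq (runs_limProg (runs_ite (fun h6 => ?_) (fun h6 => ?_)))
  · simp [Test.Holds, h4, h30, hm, mem_far hM] at h6
    exact runs_fail (by norm_num) (by simpa using hm) (by simpa using ho) (by simpa using h30)
      (hzero p₀ h6)
  simp [Test.Holds, h4, h30, hm, mem_far hM] at h6
  have e6 := hlim p₀ h6
  refine runs_seq (runs_add (runs_seq (runs_farLeftProg (runs_ite (fun hu => ?_)
    (fun hu => runs_seq (runs_limProg (runs_ite (fun h7 => ?_) (fun h7 => ?_))))))))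
  · simp [Test.Holds, h4, hm, mem_far hM, mem_farLeft hM, e6, hM.addr_injective.eq_iff] at hu
    have hc : Φ.IsCut p₀ (Φ.lim p₀) :=
      ⟨hlt, hle, le_rfl, ((Φ.farLeft_pos_eq_pos_lim_iff p₀).mp hu).le⟩
    refine runs_seq (runs_add (runs_seq (runs_add
      ((runs_finishProg hM hc ?_ ?_ ?_ ?_ ?_ ?_).mono ?_))))
    · simpa using hm
    · simpa using ho
    · simpa using hb hc.isCoBipartite
    · simp [h4]
    · simp [h4, hm, mem_far hM, e6]
    · simpa using h30
    · rintro t s' ⟨h1, h2⟩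
      exact ⟨by omega, h2⟩
  all_goals
    simp [Test.Holds, h4, h30, hm, mem_far hM, mem_farLeft hM, e6,
      hM.addr_injective.eq_iff] at hu h7
  · exact runs_fail (by norm_num) (by simpa using hm) (by simpa using ho) (by simpa using h30)
      (hzero _ h7)
  have e7 := hlim _ h7
  have hl : Φ.lim (Φ.lim p₀) ≤ p₀ + n :=
    Nat.le_of_not_lt fun h => hu ((Φ.farLeft_pos_eq_pos_lim_iff p₀).mpr h)
  refine runs_seq (runs_const (runs_seq (runs_const (runs_seq ?_))))
  refine Runs.mono (runs_extendProg hM (x₀ := p₀) (y₀ := Φ.lim p₀) (X := Φ.lim p₀)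
    (Y := Φ.lim (Φ.lim p₀)) (lx := addr (pos n (Φ.lim p₀)))
    (ly := addr (pos n (Φ.lim (Φ.lim p₀)))) (x := p₀) (y := Φ.lim p₀) ⟨le_rfl, hl⟩
    (fun _ _ _ => rfl) (fun _ _ _ => rfl) .refl hlt hlt' ?_ ?_ ?_ ?_ ?_ ?_ ?_ ?_ ?_ ?_) ?_
  · simpa using hm
  · simpa using hval p₀ h6
  · simpa using hval _ h7
  · simp [h4]
  · simp [h4, hm, mem_far hM, e6]
  · simp [h4, hm, mem_far hM, e6]
  · simp [h4, hm, mem_far hM, e6, e7]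
  · simp
  · simp
  · simp [h30]
  rintro t s' ⟨x, y, hE, hax, hx, hby, hy, ht, hm', ho', r4, r5, hfr, hend⟩
  -- No bound on `n` is available yet; the extension is paid for by the reaches of `p₀` and `lim p₀`
  -- alone.
  have d1 := Φ.lim_sub_le_maxDegree p₀
  have d2 := Φ.lim_sub_le_maxDegree (Φ.lim p₀)
  simp only [State.set_reg] at hfr
  have r30 : s'.reg 30 = 0 := by rw [hfr _ (by omega)]; simpa using h30
  have hnext : nextPtr s' = nextPtr s := by
    refine nextPtr_congr (hm'.trans hm.symm) ?_ ?_ ?_ <;>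
      · rw [hfr _ (by omega)]; simp
  refine runs_ite (fun h21 => ?_) (fun h21 => runs_emit ?_)
  · simp only [Test.Holds, r30] at h21
    obtain ⟨-, h8, h9⟩ := hend.resolve_right (by rw [h21]; simp)
    have hc : Φ.IsCut (x + 1) (y + 1) := ⟨by omega, by omega, by omega, by omega⟩
    have hn' := hb hc.isCoBipartite
    refine runs_seq (runs_succProg (by norm_num) (runs_seq (runs_succProg (by norm_num)
      ((runs_finishProg hM hc ?_ ?_ ?_ ?_ ?_ ?_).mono ?_))))
    · simpa using hm'
    · simpa [ho'] using ho
    · simpa [hnext] using hn'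
    · simp [r4, hnext, hn']
    · simp [r5, hnext, hn']
    · simpa using r30
    · rintro t s' ⟨h1, h2⟩
      exact ⟨by omega, h2⟩
  · simp only [Test.Holds, r30] at h21
    refine ⟨by omega, by simpa using hm', Or.inl ⟨?_, by simpa [ho', r30] using ho⟩⟩
    obtain ⟨h8, h9⟩ | ⟨h8, h9⟩ := (hend.resolve_left (fun h => h21 h.1)).2
    · exact hE.not_isCoBipartite_right hl hx
        (eq_of_pos_eq (k := Φ.lim p₀ + 1) (hM.addr_injective h9) (by omega) (by omega)
          (by omega) (by omega)) h8
    · exact hE.not_isCoBipartite_left hl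
        (eq_of_pos_eq (k := p₀ + 1) (hM.addr_injective h9) (by omega) (by omega)
          (by omega) (by omega)) h8

theorem runs_searchProg_mono {s : State} {c : ℕ → ℕ} (hc : ∀ t, c t ≤ t + 100)
    (h : Runs searchProg s fun t s' => Correct Φ addr m 600 t s') :
    Runs searchProg s fun t s' => Correct Φ addr m 1000 (c t) s' := by
  refine h.mono ?_
  rintro t s' ⟨h1, h2⟩
  have := hc t
  exact ⟨by omega, h2⟩

theorem runs_leftEndProg {s : State} {Q : ℕ → State → Prop} {x : ℕ}
    (hM : IsBaseRep Φ name addr m head) (hm : s.mem = m) {v : Fin n} (hv : s.reg x = addr v)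
    (h : Q 6 (s.set x (addr (Φ.farLeft (Φ.farLeft (Φ.farLeft v)))))) :
    Runs (leftEndProg x) s Q := by
  refine runs_seq (runs_farLeftProg (runs_seq (runs_farLeftProg (runs_farLeftProg ?_))))
  simpa [hm, hv, mem_farLeft hM, State.set_set] using h

theorem reachable_leftEnd (v : Fin n) :
    Φ.graph.Reachable v (Φ.farLeft (Φ.farLeft (Φ.farLeft v))) :=
  ((Φ.reachable_farLeft v).trans (Φ.reachable_farLeft _)).trans (Φ.reachable_farLeft _)

theorem nextPtr_pos (hM : IsBaseRep Φ name addr m head) {s : State} (hm : s.mem = m) (p : ℕ) :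
    nextPtr s (addr (pos n p)) = if Φ.lim p = p + 1 then
      (if addr (pos n p) = s.reg 1 then s.reg 2 else s.reg 3) else addr (pos n (p + 1)) := by
  have h := Φ.nearRight_pos_eq_iff p
  simp only [nextPtr, hm, hM.nearRight, hM.addr_injective.eq_iff, h]
  split_ifs with h1 h2
  · rfl
  · rfl
  · rw [Φ.nearRight_pos, if_neg h1]

/-- The search in a connected graph. -/
theorem runs_searchProg_connected (hM : IsBaseRep Φ name addr m head) {v : Fin n} {s : State}
    (hv : ∀ w, Φ.graph.Reachable v w) (hm : s.mem = m) (ho : s.out = []) (h1 : s.reg 1 = 0)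
    (h3 : s.reg 3 = addr v ∧ Φ.nearLeft v = v ∨
      s.reg 3 = 0 ∧ (IsCoBipartite Φ.graph → ∀ p, Φ.lim p ≠ p + 1))
    (h4 : s.reg 4 = addr v) (h30 : s.reg 30 = 0) :
    Runs searchProg s fun t s' => Correct Φ addr m 600 t s' := by
  obtain ⟨p₀, -, -, rfl⟩ := exists_pos_eq 0 v
  have hn := nextPtr_pos hM hm
  simp only [h1, hM.addr_ne_zero, if_false] at hn
  rcases h3 with ⟨h3, hl⟩ | ⟨h3, hl⟩
  · have key : ∀ p, nextPtr s (addr (pos n p)) = addr (pos n (p + 1)) := by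
      intro p
      rw [hn]
      split_ifs with h
      · rw [h3, Φ.eq_of_nearLeft_of_reachable hl ((Φ.nearLeft_pos_succ_eq_iff p).mpr h) (hv _)]
      · rfl
    exact runs_searchProg hM hm ho (fun p => Or.inl (key p)) (fun _ => key) h4 h30
  · refine runs_searchProg hM hm ho (fun p => ?_) (fun hb p => ?_) h4 h30
    · rw [hn, h3]
      split_ifs with h
      · exact Or.inr ⟨rfl, h⟩
      · exact Or.inl rfl
    · rw [hn, if_neg (hl hb p)]

/-- The search in a graph with two connected components. -/
theorem runs_searchProg_two (hM : IsBaseRep Φ name addr m head) {v w : Fin n} {s : State}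
    (hvw : ¬ Φ.graph.Reachable v w) (hu : ∀ u, Φ.graph.Reachable v u ∨ Φ.graph.Reachable w u)
    (hv : Φ.nearLeft v = v) (hw : Φ.nearLeft w = w) (hr : Φ.nearRight (Φ.far v) = Φ.far v)
    (hm : s.mem = m) (ho : s.out = []) (h1 : s.reg 1 = addr (Φ.far v)) (h2 : s.reg 2 = addr w)
    (h3 : s.reg 3 = addr v) (h4 : s.reg 4 = addr v) (h30 : s.reg 30 = 0) :
    Runs searchProg s fun t s' => Correct Φ addr m 600 t s' := by
  obtain ⟨p₀, -, -, rfl⟩ := exists_pos_eq 0 v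
  have hend : ∀ u, Φ.nearLeft u = u → u = pos n p₀ ∨ u = w := fun u h =>
    (hu u).imp (Φ.eq_of_nearLeft_of_reachable hv h) (Φ.eq_of_nearLeft_of_reachable hw h)
  -- The semiblock after a right end is a left end, and `v` and `w` are the only left ends.
  have hfar : Φ.far (pos n p₀) + 1 = w :=
    (hend _ ((Φ.nearLeft_succ_eq_iff _).mpr hr)).resolve_left (Φ.far_add_one_ne hvw)
  have key : ∀ p, nextPtr s (addr (pos n p)) = addr (pos n (p + 1)) := by
    intro p
    simp only [nextPtr_pos hM hm, h1, h2, h3, hM.addr_injective.eq_iff]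
    split_ifs with h h'
    · rw [pos_succ, h', hfar]
    · rcases hend _ ((Φ.nearLeft_pos_succ_eq_iff p).mpr h) with h5 | h5
      · rw [h5]
      · rw [← hfar, pos_succ] at h5
        exact absurd (add_right_cancel h5) h'
    · rfl
  exact runs_searchProg hM hm ho (fun p => Or.inl (key p)) (fun _ => key) h4 h30

/-- If the graph is co-bipartite and not connected, then `leftEndProg` finds left ends. -/
theorem nearLeft_leftEnd_of_not_reachable {v w : Fin n} (hvw : ¬ Φ.graph.Reachable v w)
    (hb : IsCoBipartite Φ.graph) (u : Fin n) :
    Φ.nearLeft (Φ.farLeft (Φ.farLeft (Φ.farLeft u))) =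
      Φ.farLeft (Φ.farLeft (Φ.farLeft u)) := by
  -- If no contig had a right end, steps to the right would connect `v` with `w`.
  obtain ⟨e, he⟩ : ∃ e, Φ.lim e = e + 1 := by
    by_contra hc
    push Not at hc
    refine hvw ?_
    obtain ⟨p, -, -, rfl⟩ := exists_pos_eq 0 v
    obtain ⟨q, hq, -, rfl⟩ := exists_pos_eq p w
    clear hvw
    induction q, hq using Nat.le_induction with
    | base => exact .refl _
    | succ q _ ih =>
      refine ih.trans (SimpleGraph.Adj.reachable (Or.inl ?_))
      have h1 := Φ.lt_lim q
      have h2 := Φ.lim_le q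
      have h3 := hc q
      exact (Φ.reaches_pos (by omega) (by omega)).mpr (by omega)
  exact Φ.nearLeft_farLeft_farLeft_farLeft he hb u

/-- The list of contigs is inspected only as far as needed to distinguish one, two and more
components. Failures to find an end are fatal only for two components; a connected graph may have no
ends and is searched with a null successor. -/
theorem runs_mainProg (hM : IsBaseRep Φ name addr m head) :
    Runs mainProg (start m head) fun t s' => Correct Φ addr m 1000 t s' := by
  have hm : (start m head).mem = m := rfl
  have ho : (start m head).out = [] := rfl
  have hreg : ∀ r, r ≠ 0 → (start m head).reg r = 0 := fun r hr => by simp [start, hr]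
  have h0 : (start m head).reg 0 = head := by simp [start]
  generalize start m head = s at *
  obtain ⟨l, hl, hnd, hall⟩ := hM.contigs
  have hall' : ∀ u, ∃ v ∈ l, Φ.graph.Reachable v u := by
    intro u
    obtain ⟨v, hv, hvu⟩ := List.mem_map.mp (hall (Φ.graph.connectedComponentMk u))
    exact ⟨v, hv, SimpleGraph.ConnectedComponent.exact hvu⟩
  obtain - | ⟨v, l⟩ := l
  · obtain ⟨v, hv, -⟩ := hall' 0
    simp at hv
  simp only [List.map_cons, ListAt] at hl
  obtain ⟨-, hl1, hl2⟩ := hl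
  set v' := Φ.farLeft (Φ.farLeft (Φ.farLeft v)) with hv'
  have hvv' : Φ.graph.Reachable v v' := reachable_leftEnd v
  refine runs_seq (runs_load (runs_seq (runs_load (runs_seq (runs_leftEndProg hM (v := v)
    (by simpa using hm) (by simp [hm, h0, hl1]) (runs_seq (runs_load ?_)))))))
  obtain - | ⟨w, l⟩ := l
  · simp only [List.map_nil, ListAt] at hl2
    have hcon : ∀ u, Φ.graph.Reachable v' u := by
      intro u
      obtain ⟨z, hz, hzu⟩ := hall' u
      obtain rfl := List.mem_singleton.mp hz
      exact hvv'.symm.trans hzu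
    refine runs_ite (fun _ => runs_ite (fun h => runs_seq (runs_add ?_)) (fun h => ?_))
      (fun h => absurd ?_ h)
    · refine runs_searchProg_mono (fun t => by omega)
        (runs_searchProg_connected hM (v := v') hcon ?_ ?_ ?_ (Or.inl ⟨?_, ?_⟩) ?_ ?_)
      · simpa using hm
      · simpa using ho
      · simp [hreg]
      · simp [hv']
      · simpa [Test.Holds, hm, ← hv', hM.nearLeft, hM.addr_injective.eq_iff] using h
      · simp [hv']
      · simp [hreg]
    · refine runs_searchProg_mono (fun t => by omega)
        (runs_searchProg_connected hM (v := v') hcon ?_ ?_ ?_ (Or.inr ⟨?_, ?_⟩) ?_ ?_)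
      · simpa using hm
      · simpa using ho
      · simp [hreg]
      · simp [hreg]
      · intro hb p hp
        simp [Test.Holds, hm, ← hv', hM.nearLeft, hM.addr_injective.eq_iff] at h
        exact h (Φ.nearLeft_farLeft_farLeft_farLeft hp hb v)
      · simp [hv']
      · simp [hreg]
    · simp [Test.Holds, hm, h0, hl2, hreg]
  simp only [List.map_cons, ListAt] at hl2
  obtain ⟨hl2, hl3, hl4⟩ := hl2
  simp only [List.map_cons, List.nodup_cons, List.mem_cons, not_or] at hnd
  obtain ⟨⟨hvw, hnd1⟩, hnd2, -⟩ := hnd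
  rw [SimpleGraph.ConnectedComponent.eq] at hvw
  set w' := Φ.farLeft (Φ.farLeft (Φ.farLeft w)) with hw'
  have hww' : Φ.graph.Reachable w w' := reachable_leftEnd w
  refine runs_ite (fun h => absurd h ?_) (fun _ => runs_seq (runs_load (runs_seq (runs_load
    (runs_ite (fun h => runs_ite (fun h' => ?_) (fun h' => ?_)) (fun h => ?_))))))
  · simp [Test.Holds, hm, h0, hl2, hreg]
  · obtain - | ⟨z, l⟩ := l
    swap
    · simp only [List.map_cons, ListAt] at hl4
      exact absurd h (by simp [Test.Holds, hm, h0, hl4.1, hreg])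
    have hu : ∀ u, Φ.graph.Reachable v' u ∨ Φ.graph.Reachable w' u := by
      intro u
      obtain ⟨z, hz, hzu⟩ := hall' u
      simp only [List.mem_cons, List.not_mem_nil, or_false] at hz
      rcases hz with rfl | rfl
      · exact Or.inl (hvv'.symm.trans hzu)
      · exact Or.inr (hww'.symm.trans hzu)
    have hvw' : ¬ Φ.graph.Reachable v' w' := fun hc => hvw (hvv'.trans (hc.trans hww'.symm))
    simp [Test.Holds, hm, ← hv', hM.nearLeft, hM.addr_injective.eq_iff] at h'
    refine runs_seq (runs_leftEndProg hM (v := w) (by simpa using hm) (by simp [hm, h0, hl3])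
      (runs_seq (runs_load (runs_ite (fun h5 => runs_seq (runs_load (runs_seq (runs_load
        (runs_seq (runs_load (runs_ite (fun h6 => runs_seq (runs_add (runs_seq (runs_add
          (runs_seq (runs_add ?_)))))) (fun h6 => ?_))))))))
        (fun h5 => ?_)))))
    all_goals simp [Test.Holds, hm, ← hw', hM.nearLeft, hM.addr_injective.eq_iff] at h5
    · simp [Test.Holds, hm, ← hv', mem_far hM, hM.nearRight, hM.addr_injective.eq_iff] at h6
      refine runs_searchProg_mono (fun t => by omega)
        (runs_searchProg_two hM (v := v') (w := w') hvw' hu h' h5 h6 ?_ ?_ ?_ ?_ ?_ ?_ ?_)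
      · simpa using hm
      · simpa using ho
      · simp [hm, hv', mem_far hM]
      · simp [hw']
      · simp [hv']
      · simp [hv']
      · simp [hreg]
    · refine runs_fail (by norm_num) (by simpa using hm) (by simpa using ho) (by simp [hreg])
        fun hb => ?_
      simp [Test.Holds, hm, ← hv', mem_far hM, hM.nearRight, hM.addr_injective.eq_iff] at h6
      exact h6 (Φ.nearRight_far_of_nearLeft h' hvw' hb)
    · refine runs_fail (by norm_num) (by simpa using hm) (by simpa using ho) (by simp [hreg])
        fun hb => h5 (nearLeft_leftEnd_of_not_reachable hvw hb w)
  · refine runs_fail (by norm_num) (by simpa using hm) (by simpa using ho) (by simp [hreg])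
      fun hb => ?_
    simp [Test.Holds, hm, ← hv', hM.nearLeft, hM.addr_injective.eq_iff] at h'
    exact h' (nearLeft_leftEnd_of_not_reachable hvw hb v)
  · refine runs_fail (by norm_num) (by simpa using hm) (by simpa using ho) (by simp [hreg])
      fun hb => ?_
    -- Representatives of three components form a triangle in the complement.
    obtain - | ⟨z, l⟩ := l
    · simp only [List.map_nil, ListAt] at hl4
      exact h (by simp [Test.Holds, hm, h0, hl4, hreg])
    simp only [List.map_cons, List.mem_cons, not_or] at hnd1 hnd2
    rw [SimpleGraph.ConnectedComponent.eq] at hnd1 hnd2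
    exact not_isCoBipartite_of_triangle (Φ.compl_adj_of_not_reachable hvw)
      (Φ.compl_adj_of_not_reachable hnd2.1) (Φ.compl_adj_of_not_reachable hnd1.1) hb

end CoContig

theorem mainTheorem6 :
    ∃ (P : Machine.Prog) (c : ℕ),
      ∀ (V : Type*) (n : ℕ) [NeZero n] (Φ : RoundRep V n) (name : V → ℕ) (addr : Fin n → ℕ)
        (m : ℕ → ℕ) (head : ℕ), IsBaseRep Φ name addr m head →
        ∃ (t : ℕ) (s : Machine.State),
          Machine.Exec P (Machine.start m head) t s ∧
          t ≤ c * (Φ.graph.maxDegree + 1) ∧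
          s.mem = m ∧
          ((¬ IsCoBipartite Φ.graph ∧ s.out = [0]) ∨
            (IsCoBipartite Φ.graph ∧
              ∃ L : List (Rng n × Rng n),
                Φ.IsNaturalOrdering L ∧ s.out = 1 :: pairsOutput addr L)) := by
  refine ⟨CoContig.mainProg, 1000, fun V n _ Φ name addr m head hM => ?_⟩
  obtain ⟨t, s, ⟨t₀, h1, h2⟩, h3, h4⟩ := CoContig.runs_mainProg hM
  exact ⟨t₀, s, h2, h1.trans h3, h4⟩
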